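/- **Setting.** On $\mathcal H=\ell^2(\mathbb Z)\otimes\mathbb C^2$ let $\gamma=1\otimes\sigma_1$, let $R(\theta)=1\otimes\begin{pmatrix}\cos\theta&-\sin\theta\\ \sin\theta&\cos\theta\end{pmatrix}$, let $S_\uparrow$ shift the spin-up component one cell to the right and fix the spin-down component, and let $S_\downarrow$ shift the spin-down component one cell to the left and fix the spin-up component. The split-step walk and its half-step operator are $$W(\theta_1,\theta_2)=R(\tfrac{\theta_1}{2})S_\downarrow R(\theta_2)S_\uparrow R(\tfrac{\theta_1}{2}),\qquad F(\theta_1,\theta_2)=R(\tfrac{\theta_2}{2})S_\uparrow R(\tfrac{\theta_1}{2}).$$ The two timeframes of a unitary $F$ are $W=\gamma F^*\gamma F$ and $W'=F\gamma F^*\gamma$. The standard cells of $\mathcal H$ are $\mathcal H_x=\mathbb C\delta_x\otimes\mathbb C^2$. A *regrouping* merges neighbouring cells: for a strictly increasing $c:\mathbb Z\to\mathbb Z$ the new cell $y$ is $\bigoplus_{c(y)\le x<c(y+1)}\mathcal H_x$ (trivial regrouping allowed). For a cell structure let $P_{\ge a}$ be the orthogonal projection onto the half-chain formed by all cells with label $\ge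 a$. An operator $X$ is *essentially local* if $[X,P_{\ge a}]$ is compact for all $a$. A unitary is *essentially gapped* if each of $\pm1$ is isolated in, or not in, its spectrum and has a finite-dimensional eigenspace. A *half-step walk* is an essentially local unitary $F$ whose timeframes $W$ and $W'$ are both essentially gapped. A *chiral symmetric walk* is an essentially local, essentially gapped unitary $V$ with $\gamma V\gamma^*=V^*$. Its right symmetry index is $$\overrightarrow{\mathrm{si}}(V)=\dim(K_a\cap\ker(\gamma-1))-\dim(K_a\cap\ker(\gamma+1)),$$ where $K_a\subset P_{\ge a}\mathcal H$ is the kernel of $(X-X^*)/2i$ on the half-chain $P_{\ge a}\mathcal H$ for $X=P_{\ge a}VP_{\ge a}$; to say that the index equals $n$ means that these two spaces are finite-dimensional and their dimensions differ by $n$ for every cut point $a$. **Statement.** For the standard cell structure and for every regrouping of it the following holds. 1. For all $(\theta_1,\theta_2)\in\mathbb R^2$, the first timeframe of $F(\theta_1,\theta_2)$ is $W(\theta_1,\theta_2)$, and $F(\theta_1,\theta_2)$ is unitary and essentially local. Each of the timeframes $W$, $W'$ of $F(\theta_1,\theta_2)$ is essentially gapped if and only if $|\sin\theta_1|\ne|\sin\theta_2|$.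 2. Among the parameters with open gaps, $\overrightarrow{\mathrm{si}}(W)=0$ holds exactly on the union of the two patches $$\mathcal P_+=\{\sin\theta_2>|\sin\theta_1|\}\ni(0,\tfrac\pi2),\qquad \mathcal P_-=\{\sin\theta_2<-|\sin\theta_1|\}\ni(0,-\tfrac\pi2).$$ 3. $\overrightarrow{\mathrm{si}}(W')=+1$ on $\mathcal P_+$ and $\overrightarrow{\mathrm{si}}(W')=-1$ on $\mathcal P_-$. 4. There is no bridge between the two patches that leaves the gaps of both timeframes open: if $\theta\in\mathcal P_+$ and $\eta\in\mathcal P_-$, there is no norm-continuous path from $F(\theta)$ to $F(\eta)$ in the set of half-step walks. 5. Not even the second timeframes can be connected: if $\theta\in\mathcal P_+$ and $\eta\in\mathcal P_-$, there is no norm-continuous path from $W'(\theta)$ to $W'(\eta)$ in the set of chiral symmetric walks. In particular there is no homotopy of the pair $(W,W')$ of timeframes between the two patches. -/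

import Mathlib

open scoped Topology

noncomputable section

/-! ### One-dimensional cell structures and half-chains -/

section General

variable {H : Type*} [NormedAddCommGroup H] [InnerProductSpace ℂ H]

/-- A one-dimensional cell structure on `H`: an orthogonal decomposition of `H` as the Hilbert space
direct sum of finite-dimensional subspaces (the cells) labelled by the integers. -/
structure CellStructure (H : Type*) [NormedAddCommGroup H] [InnerProductSpace ℂ H] where
  cell : ℤ → Submodule ℂ H
  finiteDimensional : ∀ x, FiniteDimensional ℂ (cell x)
  orthogonal : ∀ x y, x ≠ y → cell x ⟂ cell y
  dense : (⨆ x, cell x).topologicalClosure = ⊤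

namespace CellStructure

/-- Regrouping of neighbouring cells: the new cell `y` is the direct sum of the old cells `x` with
`c y ≤ x < c (y + 1)`, where `c` is a strictly increasing sequence of cut points. -/
def regroup (cells : CellStructure H) (c : ℤ → ℤ) (hc : StrictMono c) : CellStructure H where
  cell y := ⨆ x : Set.Ico (c y) (c (y + 1)), cells.cell x
  finiteDimensional y := by
    have := cells.finiteDimensional
    infer_instance
  orthogonal := by
    have key : ∀ y z : ℤ, y < z →
        (⨆ x : Set.Ico (c y) (c (y + 1)), cells.cell x) ⟂
          ⨆ x : Set.Ico (c z) (c (z + 1)), cells.cell x := by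
      intro y z hyz
      rw [Submodule.isOrtho_iSup_left]
      intro i
      rw [Submodule.isOrtho_iSup_right]
      intro j
      refine cells.orthogonal _ _ (ne_of_lt ?_)
      have h1 := i.2.2
      have h2 := j.2.1
      have h3 : c (y + 1) ≤ c z := hc.monotone (by omega)
      omega
    intro y z hyz
    rcases lt_or_gt_of_ne hyz with h | h
    · exact key y z h
    · exact (key z y h).symm
  dense := by
    rw [← top_le_iff, ← cells.dense]
    refine Submodule.topologicalClosure_mono (iSup_le fun x => ?_)
    have hup : ∀ n : ℕ, c 0 + n ≤ c n := by
      intro n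
      induction n with
      | zero => simp
      | succ n ih =>
        have := hc (show (n : ℤ) < ((n + 1 : ℕ) : ℤ) by push_cast; omega)
        push_cast at this ⊢
        omega
    have hdown : ∀ n : ℕ, c (-n) ≤ c 0 - n := by
      intro n
      induction n with
      | zero => simp
      | succ n ih =>
        have := hc (show (-((n + 1 : ℕ) : ℤ)) < -(n : ℤ) by push_cast; omega)
        push_cast at this ⊢
        omega
    obtain ⟨y, hy, hmax⟩ := Int.exists_greatest_of_bdd (P := fun y => c y ≤ x)
      ⟨((x - c 0).toNat + 1 : ℕ), fun z hz => by
        by_contra hlt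
        have h1 := hc (not_le.mp hlt)
        have h2 := hup ((x - c 0).toNat + 1)
        push_cast at h1 h2
        omega⟩
      ⟨-((c 0 - x).toNat : ℤ), by
        have := hdown (c 0 - x).toNat
        show c _ ≤ x
        omega⟩
    have hlt : x < c (y + 1) := by
      by_contra hle
      have := hmax (y + 1) (not_lt.mp hle)
      omega
    exact le_trans (le_iSup (fun i : Set.Ico (c y) (c (y + 1)) => cells.cell i) ⟨x, hy, hlt⟩)
      (le_iSup (fun y => ⨆ i : Set.Ico (c y) (c (y + 1)), cells.cell i) y)

/-- `cells'` arises from `cells` by regrouping neighbouring cells (possibly trivially). -/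
def IsRegroupingOf (cells' cells : CellStructure H) : Prop :=
  ∃ (c : ℤ → ℤ) (hc : StrictMono c), cells' = cells.regroup c hc

theorem isRegroupingOf_refl (cells : CellStructure H) : cells.IsRegroupingOf cells := by
  refine ⟨id, strictMono_id, ?_⟩
  have h : cells.cell = (cells.regroup id strictMono_id).cell := by
    funext y
    apply le_antisymm
    · exact le_iSup (fun i : Set.Ico (id y) (id (y + 1)) => cells.cell i)
        ⟨y, by simp⟩
    · refine iSup_le fun i => ?_
      have h1 := i.2.1
      have h2 := i.2.2
      simp only [id] at h1 h2
      rw [show (i : ℤ) = y by omega]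
  cases cells
  simp only [regroup] at h ⊢
  congr

/-- The right half-chain: the closed span of all cells `x ≥ a`. -/
def halfChain (cells : CellStructure H) (a : ℤ) : Submodule ℂ H :=
  (⨆ x : Set.Ici a, cells.cell x).topologicalClosure

end CellStructure

variable [CompleteSpace H]

instance (cells : CellStructure H) (a : ℤ) : (cells.halfChain a).HasOrthogonalProjection :=
  inferInstanceAs ((⨆ x : Set.Ici a, cells.cell x).topologicalClosure).HasOrthogonalProjection

/-- The orthogonal projection of `H` onto the right half-chain starting at `a`. -/
def CellStructure.halfProj (cells : CellStructure H) (a : ℤ) : H →L[ℂ] H :=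
  (cells.halfChain a).starProjection

/-! ### Chiral symmetric walks, half-step walks and the right symmetry index -/

/-- Essential locality: the commutator with every half-chain projection is compact. -/
def IsEssentiallyLocal (cells : CellStructure H) (X : H →L[ℂ] H) : Prop :=
  ∀ a : ℤ, IsCompactOperator (X * cells.halfProj a - cells.halfProj a * X)

/-- The spectrum of `W` at `z` is isolated and finitely degenerate (or `z` is not in the
spectrum). -/
def IsEssentiallyGappedAt (W : H →L[ℂ] H) (z : ℂ) : Prop :=
  (∀ᶠ w in 𝓝[≠] z, w ∉ spectrum ℂ W) ∧
    FiniteDimensional ℂ (Module.End.eigenspace (W : H →ₗ[ℂ] H) z)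

/-- Essential gaps at both symmetry-invariant points `1` and `-1`. -/
def IsEssentiallyGapped (W : H →L[ℂ] H) : Prop :=
  IsEssentiallyGappedAt W 1 ∧ IsEssentiallyGappedAt W (-1)

/-- Chiral symmetric walks (for the chiral symmetry `γ`): unitary, essentially local,
`γ W γ* = W*`, and essentially gapped at `1` and `-1`. -/
structure IsChiralWalk (cells : CellStructure H) (γ W : H →L[ℂ] H) : Prop where
  unitary : W ∈ unitary (H →L[ℂ] H)
  essLocal : IsEssentiallyLocal cells W
  chiral : γ * W * star γ = star W
  gapped : IsEssentiallyGapped W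

/-- The first timeframe `W = γ F* γ F` of the half-step operator `F`. -/
def timeframeW (γ F : H →L[ℂ] H) : H →L[ℂ] H := γ * star F * γ * F

/-- The second timeframe `W′ = F γ F* γ` of the half-step operator `F`. -/
def timeframeW' (γ F : H →L[ℂ] H) : H →L[ℂ] H := F * γ * star F * γ

/-- Half-step walks: unitary, essentially local, with both timeframes essentially gapped. -/
structure IsHalfStepWalk (cells : CellStructure H) (γ F : H →L[ℂ] H) : Prop where
  unitary : F ∈ unitary (H →L[ℂ] H)
  essLocal : IsEssentiallyLocal cells F
  gappedW : IsEssentiallyGapped (timeframeW γ F)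
  gappedW' : IsEssentiallyGapped (timeframeW' γ F)

/-- The imaginary part `(X - X*) / 2i`. -/
def imPart (X : H →L[ℂ] H) : H →L[ℂ] H := (2 * Complex.I)⁻¹ • (X - star X)

/-- The vectors of the right half-chain at `a` that lie in the kernel of the imaginary part of the
half-chain operator `P W P` and in the `ε`-eigenspace of `γ`. -/
def halfChainKernel (cells : CellStructure H) (γ W : H →L[ℂ] H) (a : ℤ) (ε : ℂ) :
    Submodule ℂ H :=
  cells.halfChain a ⊓
    LinearMap.ker (imPart (cells.halfProj a * W * cells.halfProj a) : H →ₗ[ℂ] H) ⊓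
    Module.End.eigenspace (γ : H →ₗ[ℂ] H) ε

/-- The right symmetry index of `W` is defined and equal to `n`: for every cut point `a`, the
kernel of the imaginary part of `P W P` on the half-chain is finite-dimensional, and the dimensions
of its `γ = 1` and `γ = -1` parts differ by `n`. -/
def HasRightSymmetryIndex (cells : CellStructure H) (γ W : H →L[ℂ] H) (n : ℤ) : Prop :=
  ∀ a : ℤ,
    FiniteDimensional ℂ (halfChainKernel cells γ W a 1) ∧
    FiniteDimensional ℂ (halfChainKernel cells γ W a (-1)) ∧
    (Module.finrank ℂ (halfChainKernel cells γ W a 1) : ℤ) -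
      (Module.finrank ℂ (halfChainKernel cells γ W a (-1)) : ℤ) = n

end General

/-! ### The split-step walk -/

namespace SplitStep

/-- The internal space `ℂ²`; index `0` is spin-up and index `1` is spin-down. -/
abbrev Spin : Type := EuclideanSpace ℂ (Fin 2)

/-- The Hilbert space `ℓ²(ℤ) ⊗ ℂ²`, as the space of square-summable functions `ℤ → ℂ²`. -/
abbrev Hilb : Type := lp (fun _ : ℤ => Spin) 2

/-- The standard cell structure: the cell at `x` consists of the functions supported at `x`. -/
def stdCells : CellStructure Hilb where
  cell x := LinearMap.range (lp.lsingle (𝕜 := ℂ) (E := fun _ : ℤ => Spin) 2 x)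
  finiteDimensional x := inferInstance
  orthogonal x y hxy := by
    rw [Submodule.isOrtho_iff_inner_eq]
    rintro _ ⟨u, rfl⟩ _ ⟨v, rfl⟩
    show inner ℂ (lp.single (E := fun _ : ℤ => Spin) 2 x u)
      (lp.single (E := fun _ : ℤ => Spin) 2 y v) = 0
    rw [lp.inner_single_left, lp.single_apply_ne _ _ _ hxy, inner_zero_right]
  dense := by
    rw [eq_top_iff]
    intro f _
    have h := lp.hasSum_single (E := fun _ : ℤ => Spin) (p := 2) (by simp) f
    refine mem_closure_of_tendsto h (Filter.Eventually.of_forall fun s => ?_)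
    refine Submodule.sum_mem _ fun x _ => ?_
    exact Submodule.mem_iSup_of_mem x ⟨f x, rfl⟩

/-- The operator `1 ⊗ M`, acting by the matrix `M` in every cell. -/
def cellwise (M : Matrix (Fin 2) (Fin 2) ℂ) : Hilb →L[ℂ] Hilb :=
  lp.mapCLM 2 (fun _ : ℤ => (Matrix.toEuclideanCLM (𝕜 := ℂ) M : Spin →L[ℂ] Spin))
    (norm_nonneg _) (fun _ => le_refl _)

/-- The translation by `n` cells, `(T_n φ)(x) = φ(x - n)`; `n = 1` is the right shift `S ⊗ 1` and
`n = -1` is its inverse. -/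
def translation (n : ℤ) : Hilb →L[ℂ] Hilb :=
  LinearMap.mkContinuous
    { toFun := fun φ => ⟨fun x => φ (x - n), memℓp_gen
        ((Equiv.subRight n).summable_iff.mpr ((lp.memℓp φ).summable (by simp)))⟩
      map_add' := fun _ _ => rfl
      map_smul' := fun _ _ => rfl } 1
    (fun φ => by
      rw [one_mul, lp.norm_eq_tsum_rpow (by simp), lp.norm_eq_tsum_rpow (by simp)]
      exact le_of_eq (congrArg (fun t : ℝ => t ^ (1 / (2 : ENNReal).toReal))
        ((Equiv.subRight n).tsum_eq fun x => ‖φ x‖ ^ (2 : ENNReal).toReal)))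

/-- The rotation `R(θ) = 1 ⊗ R₂(θ)` of the internal degree of freedom. -/
def rot (θ : ℝ) : Hilb →L[ℂ] Hilb :=
  cellwise !![(Real.cos θ : ℂ), -(Real.sin θ : ℂ); (Real.sin θ : ℂ), (Real.cos θ : ℂ)]

/-- `S_↑`: shifts the spin-up vectors to the right and leaves the spin-down vectors fixed. -/
def shiftUp : Hilb →L[ℂ] Hilb :=
  translation 1 * cellwise !![1, 0; 0, 0] + cellwise !![0, 0; 0, 1]

/-- `S_↓`: shifts the spin-down vectors to the left and leaves the spin-up vectors fixed. -/
def shiftDown : Hilb →L[ℂ] Hilb :=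
  cellwise !![1, 0; 0, 0] + translation (-1) * cellwise !![0, 0; 0, 1]

/-- The chiral symmetry `γ = 1 ⊗ σ₁`. -/
def chi : Hilb →L[ℂ] Hilb := cellwise !![0, 1; 1, 0]

/-- The split-step walk `W(θ₁, θ₂) = R(θ₁/2) S_↓ R(θ₂) S_↑ R(θ₁/2)`. -/
def walk (θ : ℝ × ℝ) : Hilb →L[ℂ] Hilb :=
  rot (θ.1 / 2) * shiftDown * rot θ.2 * shiftUp * rot (θ.1 / 2)

/-- The half-step walk `F(θ₁, θ₂) = R(θ₂/2) S_↑ R(θ₁/2)` of the split-step walk. -/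
def halfStep (θ : ℝ × ℝ) : Hilb →L[ℂ] Hilb :=
  rot (θ.2 / 2) * shiftUp * rot (θ.1 / 2)

/-- The patch of the phase diagram around `(0, π/2)`. -/
def patchPlus : Set (ℝ × ℝ) := {θ | |Real.sin θ.1| < Real.sin θ.2}

/-- The patch of the phase diagram around `(0, -π/2)`. -/
def patchMinus : Set (ℝ × ℝ) := {θ | Real.sin θ.2 < -|Real.sin θ.1|}

end SplitStep

end

/-! Split `F` into blocks along the eigenspaces of `γ`. With `T` the right shift and `cp t ^ 2 = 1 +
sin t`, `cm t ^ 2 = 1 - sin t`, the blocks are, up to the factor 1/2, first-order operators `uT +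
v`: `A = cp θ₂ cm θ₁ T + cm θ₂ cp θ₁` from + to +, `B = cp θ₂ cp θ₁ T - cm θ₂ cm θ₁` from - to +,
and `C = cm θ₂ cm θ₁ T - cp θ₂ cp θ₁` from + to -. Unitarity of `F` makes `W - W*` a multiple of
`B*A` on `γ = 1` and of `A*B` on `γ = -1`; for `W'` the products are `A*C` and `C*A`.

On a half-line the equation given by such a product is solved one factor at a time (`ImFactors`).
When no factor has coefficients of equal modulus, the ℓ² kernel has dimension one if the right
factor has `|u| < |v|` and the left one `|v'| < |u'|`, and is zero otherwise. For `A` the comparison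
is that of `sin θ₁` with `sin θ₂`; for `B` and `C` it is the sign of `sin θ₁ + sin θ₂`, with
opposite outcomes. Hence where `A` and `B` balance, so that the index of `W` is 0, `A` and `C` do
not, and the index of `W'` is ±1.

Both timeframes satisfy `U + U* = cos θ₁ cos θ₂ (T + T⁻¹) - 2 sin θ₁ sin θ₂`, so `|U - η|²` is a
discrete Laplacian plus a constant for `η = ±1`, and its gap closes exactly when `sin θ₁ + η sin θ₂
= 0` (`isEssentiallyGapped_iff`).

The obstruction to paths is homotopy invariance of the index (`chainIndex_eq_of_joinedIn`).
Essential gaps and essential locality give the compressed imaginary part an inverse modulo compacts,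
and a Schur complement reduces a small perturbation to an odd self-adjoint operator on a
finite-dimensional graded space, whose index depends on the space only. Since `F ↦ W'` is
continuous, a path of half-step walks would give a path of second timeframes. -/

noncomputable section

/-! ### The split-step walk in coordinates -/

namespace SplitStep

theorem Hilb.ext {φ ψ : Hilb} (h : ∀ x i, φ x i = ψ x i) : φ = ψ := by
  ext x i
  exact h x i

theorem Hilb.smul_apply (c : ℂ) (φ : Hilb) (x : ℤ) (i : Fin 2) : (c • φ) x i = c * φ x i := rfl

theorem Hilb.add_apply (φ ψ : Hilb) (x : ℤ) (i : Fin 2) : (φ + ψ) x i = φ x i + ψ x i := rfl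

theorem Hilb.sub_apply (φ ψ : Hilb) (x : ℤ) (i : Fin 2) : (φ - ψ) x i = φ x i - ψ x i := rfl

@[simp]
theorem translation_apply (n : ℤ) (φ : Hilb) (x : ℤ) : translation n φ x = φ (x - n) := rfl

@[simp]
theorem cellwise_apply (M : Matrix (Fin 2) (Fin 2) ℂ) (φ : Hilb) (x : ℤ) (i : Fin 2) :
    cellwise M φ x i = M i 0 * φ x 0 + M i 1 * φ x 1 := by
  have : cellwise M φ x = Matrix.toEuclideanCLM (𝕜 := ℂ) M (φ x) := rfl
  rw [this, Matrix.ofLp_toEuclideanCLM]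
  simp [Matrix.mulVec, dotProduct]

theorem cellwise_mul (M N : Matrix (Fin 2) (Fin 2) ℂ) :
    cellwise M * cellwise N = cellwise (M * N) := by
  refine ContinuousLinearMap.ext fun φ => Hilb.ext fun x i => ?_
  simp only [mul_apply_eq_comp, cellwise_apply, Matrix.mul_apply, Fin.sum_univ_two]
  ring

theorem star_cellwise (M : Matrix (Fin 2) (Fin 2) ℂ) :
    star (cellwise M) = cellwise M.conjTranspose := by
  rw [ContinuousLinearMap.star_eq_adjoint]
  symm
  rw [ContinuousLinearMap.eq_adjoint_iff]
  intro φ ψ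
  rw [lp.inner_eq_tsum, lp.inner_eq_tsum]
  refine tsum_congr fun x => ?_
  simp only [PiLp.inner_apply, cellwise_apply, Fin.sum_univ_two, Matrix.conjTranspose_apply,
    RCLike.inner_apply, map_add, map_mul, RCLike.star_def, RCLike.conj_conj]
  ring

theorem star_translation (n : ℤ) : star (translation n) = translation (-n) := by
  rw [ContinuousLinearMap.star_eq_adjoint]
  symm
  rw [ContinuousLinearMap.eq_adjoint_iff]
  intro φ ψ
  rw [lp.inner_eq_tsum, lp.inner_eq_tsum, ← (Equiv.subRight n).tsum_eq]
  refine tsum_congr fun x => ?_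
  simp

theorem translation_mul (m n : ℤ) : translation m * translation n = translation (m + n) := by
  refine ContinuousLinearMap.ext fun φ => Hilb.ext fun x i => ?_
  simp [sub_sub]

theorem translation_zero : translation 0 = 1 := by
  refine ContinuousLinearMap.ext fun φ => Hilb.ext fun x i => ?_
  simp

theorem translation_mul_cellwise (n : ℤ) (M : Matrix (Fin 2) (Fin 2) ℂ) :
    translation n * cellwise M = cellwise M * translation n := by
  refine ContinuousLinearMap.ext fun φ => Hilb.ext fun x i => ?_
  simp

theorem norm_translation_apply (n : ℤ) (φ : Hilb) : ‖translation n φ‖ = ‖φ‖ := by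
  rw [lp.norm_eq_tsum_rpow (by simp), lp.norm_eq_tsum_rpow (by simp)]
  exact congrArg (fun t : ℝ => t ^ (1 / (2 : ENNReal).toReal))
    ((Equiv.subRight n).tsum_eq fun x => ‖φ x‖ ^ (2 : ENNReal).toReal)

@[simp]
theorem rot_apply_zero (t : ℝ) (φ : Hilb) (x : ℤ) :
    rot t φ x 0 = Real.cos t * φ x 0 - Real.sin t * φ x 1 := by
  simp [rot, sub_eq_add_neg]

@[simp]
theorem rot_apply_one (t : ℝ) (φ : Hilb) (x : ℤ) :
    rot t φ x 1 = Real.sin t * φ x 0 + Real.cos t * φ x 1 := by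
  simp [rot]

theorem star_rot (t : ℝ) : star (rot t) = rot (-t) := by
  rw [rot, rot, star_cellwise]
  congr 1
  ext i j
  fin_cases i <;> fin_cases j <;> simp [-Complex.ofReal_cos, -Complex.ofReal_sin]

theorem rot_mul_rot (s t : ℝ) : rot s * rot t = rot (s + t) := by
  rw [rot, rot, cellwise_mul, rot]
  congr 1
  ext i j
  fin_cases i <;> fin_cases j <;>
    simp [-Complex.ofReal_cos, -Complex.ofReal_sin, Real.cos_add, Real.sin_add] <;> ring

theorem rot_zero : rot 0 = 1 := by
  refine ContinuousLinearMap.ext fun φ => Hilb.ext fun x i => ?_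
  fin_cases i <;> simp

@[simp]
theorem shiftUp_apply_zero (φ : Hilb) (x : ℤ) : shiftUp φ x 0 = φ (x - 1) 0 := by
  simp [shiftUp]

@[simp]
theorem shiftUp_apply_one (φ : Hilb) (x : ℤ) : shiftUp φ x 1 = φ x 1 := by
  simp [shiftUp]

@[simp]
theorem shiftDown_apply_zero (φ : Hilb) (x : ℤ) : shiftDown φ x 0 = φ x 0 := by
  simp [shiftDown]

@[simp]
theorem shiftDown_apply_one (φ : Hilb) (x : ℤ) : shiftDown φ x 1 = φ (x + 1) 1 := by
  simp [shiftDown]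

/-- The adjoint of `S_↑`, shifting the spin-up component to the left. -/
def shiftUpInv : Hilb →L[ℂ] Hilb :=
  translation (-1) * cellwise !![1, 0; 0, 0] + cellwise !![0, 0; 0, 1]

@[simp]
theorem shiftUpInv_apply_zero (φ : Hilb) (x : ℤ) : shiftUpInv φ x 0 = φ (x + 1) 0 := by
  simp [shiftUpInv]

@[simp]
theorem shiftUpInv_apply_one (φ : Hilb) (x : ℤ) : shiftUpInv φ x 1 = φ x 1 := by
  simp [shiftUpInv]

theorem star_shiftUp : star shiftUp = shiftUpInv := by
  rw [shiftUp, shiftUpInv, star_add, star_mul, star_cellwise, star_cellwise, star_translation,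
    translation_mul_cellwise]
  congr 2
  · congr 1
    ext i j
    fin_cases i <;> fin_cases j <;> simp
  · ext i j
    fin_cases i <;> fin_cases j <;> simp

theorem shiftUpInv_mul_shiftUp : shiftUpInv * shiftUp = 1 := by
  refine ContinuousLinearMap.ext fun φ => Hilb.ext fun x i => ?_
  fin_cases i <;> simp

theorem shiftUp_mul_shiftUpInv : shiftUp * shiftUpInv = 1 := by
  refine ContinuousLinearMap.ext fun φ => Hilb.ext fun x i => ?_
  fin_cases i <;> simp

theorem rot_mem_unitary (t : ℝ) : rot t ∈ unitary (Hilb →L[ℂ] Hilb) := by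
  rw [Unitary.mem_iff, star_rot, rot_mul_rot, rot_mul_rot]
  simp [rot_zero]

theorem shiftUp_mem_unitary : shiftUp ∈ unitary (Hilb →L[ℂ] Hilb) := by
  rw [Unitary.mem_iff, star_shiftUp]
  exact ⟨shiftUpInv_mul_shiftUp, shiftUp_mul_shiftUpInv⟩

theorem halfStep_mem_unitary (θ : ℝ × ℝ) : halfStep θ ∈ unitary (Hilb →L[ℂ] Hilb) :=
  mul_mem (mul_mem (rot_mem_unitary _) shiftUp_mem_unitary) (rot_mem_unitary _)

theorem star_halfStep (θ : ℝ × ℝ) :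
    star (halfStep θ) = rot (-(θ.1 / 2)) * shiftUpInv * rot (-(θ.2 / 2)) := by
  rw [halfStep, star_mul, star_mul, star_rot, star_rot, star_shiftUp, mul_assoc]

@[simp]
theorem chi_apply_zero (φ : Hilb) (x : ℤ) : chi φ x 0 = φ x 1 := by
  simp [chi]

@[simp]
theorem chi_apply_one (φ : Hilb) (x : ℤ) : chi φ x 1 = φ x 0 := by
  simp [chi]

theorem star_chi : star chi = chi := by
  rw [chi, star_cellwise]
  congr 1
  ext i j
  fin_cases i <;> fin_cases j <;> simp

theorem chi_mul_chi : chi * chi = 1 := by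
  refine ContinuousLinearMap.ext fun φ => Hilb.ext fun x i => ?_
  fin_cases i <;> simp

theorem chi_mem_unitary : chi ∈ unitary (Hilb →L[ℂ] Hilb) := by
  rw [Unitary.mem_iff, star_chi]
  exact ⟨chi_mul_chi, chi_mul_chi⟩

theorem chi_mul_rot_mul_chi (t : ℝ) : chi * rot t * chi = rot (-t) := by
  refine ContinuousLinearMap.ext fun φ => Hilb.ext fun x i => ?_
  fin_cases i <;> simp [-Complex.ofReal_cos, -Complex.ofReal_sin] <;> ring

theorem chi_mul_shiftUpInv_mul_chi : chi * shiftUpInv * chi = shiftDown := by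
  refine ContinuousLinearMap.ext fun φ => Hilb.ext fun x i => ?_
  fin_cases i <;> simp

theorem timeframeW_halfStep (θ : ℝ × ℝ) : timeframeW chi (halfStep θ) = walk θ := by
  have h : chi * star (halfStep θ) * chi =
      (chi * rot (-(θ.1 / 2)) * chi) * (chi * shiftUpInv * chi) *
        (chi * rot (-(θ.2 / 2)) * chi) := by
    rw [star_halfStep]
    simp only [mul_assoc]
    simp only [← mul_assoc chi chi, chi_mul_chi, one_mul]
  rw [timeframeW, h, chi_mul_rot_mul_chi, chi_mul_rot_mul_chi, chi_mul_shiftUpInv_mul_chi,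
    halfStep, walk, neg_neg, neg_neg]
  have h2 : rot θ.2 = rot (θ.2 / 2) * rot (θ.2 / 2) := by rw [rot_mul_rot, add_halves]
  rw [h2]
  simp only [mul_assoc]

theorem star_walk (θ : ℝ × ℝ) : star (walk θ) =
    rot (-(θ.1 / 2)) * shiftUpInv * rot (-θ.2) * star shiftDown * rot (-(θ.1 / 2)) := by
  simp only [walk, star_mul, star_rot, star_shiftUp, mul_assoc]

theorem star_shiftDown : star shiftDown = chi * shiftUp * chi := by
  rw [← chi_mul_shiftUpInv_mul_chi, star_mul, star_mul, star_chi, ← star_shiftUp, star_star,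
    mul_assoc]

/-- In momentum space `W` is a 2×2 unitary of determinant one, so `W + W*` is its trace times the
identity. This dispersion relation is all that the gap analysis needs. -/
theorem walk_add_star_walk (θ : ℝ × ℝ) :
    walk θ + star (walk θ) =
      ((Real.cos θ.1 * Real.cos θ.2 : ℝ) : ℂ) • (translation 1 + translation (-1)) -
        ((2 * Real.sin θ.1 * Real.sin θ.2 : ℝ) : ℂ) • (1 : Hilb →L[ℂ] Hilb) := by
  have hs : Real.sin θ.1 = 2 * Real.sin (θ.1 / 2) * Real.cos (θ.1 / 2) := by
    rw [← Real.sin_two_mul, mul_div_cancel₀ _ two_ne_zero]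
  have hc : Real.cos θ.1 = Real.cos (θ.1 / 2) ^ 2 - Real.sin (θ.1 / 2) ^ 2 := by
    rw [← Real.cos_two_mul', mul_div_cancel₀ _ two_ne_zero]
  rw [star_walk, star_shiftDown, walk, hs, hc]
  refine ContinuousLinearMap.ext fun φ => Hilb.ext fun x i => ?_
  simp only [add_apply, sub_apply,
    smul_apply, Hilb.add_apply, Hilb.sub_apply, Hilb.smul_apply]
  fin_cases i <;> simp [-Complex.ofReal_cos, -Complex.ofReal_sin] <;> ring

end SplitStep

/-! ### Regrouping and the algebra of essentially local operators -/

section General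

variable {H : Type*} [NormedAddCommGroup H] [InnerProductSpace ℂ H]

theorem isCompactOperator_of_forall_mem (T : H →L[ℂ] H) (N : Submodule ℂ H)
    [FiniteDimensional ℂ N] (h : ∀ x, T x ∈ N) : IsCompactOperator T := by
  have h1 : IsCompactOperator (T.codRestrict N h) := by
    have : ProperSpace N := FiniteDimensional.proper ℂ N
    exact isCompactOperator_of_locallyCompactSpace_dom (T.codRestrict N h)
  have h2 := h1.clm_comp N.subtypeL
  exact h2

/-- Regrouping only restricts the available cut points to the values of `c`. Every claim about a
regrouping therefore follows from the claim for the original cells at all cuts. -/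
theorem CellStructure.halfChain_regroup (cells : CellStructure H) (c : ℤ → ℤ) (hc : StrictMono c)
    (a : ℤ) : (cells.regroup c hc).halfChain a = cells.halfChain (c a) := by
  unfold CellStructure.halfChain
  congr 1
  apply le_antisymm
  · refine iSup_le fun y => iSup_le fun x => ?_
    exact le_iSup (fun i : Set.Ici (c a) => cells.cell i)
      ⟨x, (hc.monotone y.2).trans x.2.1⟩
  · refine iSup_le fun x => ?_
    have hup : ∀ n : ℕ, c a + n ≤ c (a + n) := by
      intro n
      induction n with
      | zero => simp
      | succ n ih =>
        have := hc (show a + (n : ℤ) < a + ((n + 1 : ℕ) : ℤ) by push_cast; omega)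
        push_cast at this ⊢
        omega
    have hx : c a ≤ (x : ℤ) := x.2
    -- The new cell containing `x` has the largest label `y` with `c y ≤ x`; strict growth of `c`
    -- bounds such labels.
    obtain ⟨y, hy, hmax⟩ := Int.exists_greatest_of_bdd (P := fun y => c y ≤ (x : ℤ))
      ⟨a + (((x : ℤ) - c a).toNat + 1 : ℕ), fun z hz => by
        by_contra hlt
        have h1 := hc (not_le.mp hlt)
        have h2 := hup (((x : ℤ) - c a).toNat + 1)
        omega⟩
      ⟨a, hx⟩
    have hay : a ≤ y := hmax a hx
    have hlt : (x : ℤ) < c (y + 1) := by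
      by_contra hle
      have := hmax (y + 1) (not_lt.mp hle)
      omega
    exact le_trans (le_iSup (fun i : Set.Ico (c y) (c (y + 1)) => cells.cell i) ⟨x, hy, hlt⟩)
      (le_iSup (fun y : Set.Ici a =>
        ⨆ i : Set.Ico (c y) (c (y + 1)), cells.cell i) ⟨y, hay⟩)

variable [CompleteSpace H]

theorem CellStructure.halfProj_regroup (cells : CellStructure H) (c : ℤ → ℤ) (hc : StrictMono c)
    (a : ℤ) : (cells.regroup c hc).halfProj a = cells.halfProj (c a) := by
  unfold CellStructure.halfProj
  congr 1
  exact cells.halfChain_regroup c hc a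

theorem CellStructure.halfProj_mul_self (cells : CellStructure H) (a : ℤ) :
    cells.halfProj a * cells.halfProj a = cells.halfProj a :=
  (cells.halfChain a).isIdempotentElem_starProjection

theorem CellStructure.star_halfProj (cells : CellStructure H) (a : ℤ) :
    star (cells.halfProj a) = cells.halfProj a :=
  isSelfAdjoint_starProjection _

theorem CellStructure.halfProj_apply_eq_self_iff (cells : CellStructure H) (a : ℤ) (φ : H) :
    cells.halfProj a φ = φ ↔ φ ∈ cells.halfChain a :=
  Submodule.starProjection_eq_self_iff

namespace IsEssentiallyLocal

variable {cells : CellStructure H} {X Y : H →L[ℂ] H}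

theorem of_commute (h : ∀ a, X * cells.halfProj a = cells.halfProj a * X) :
    IsEssentiallyLocal cells X := by
  intro a
  rw [h a, sub_self]
  exact isCompactOperator_zero

theorem add (hX : IsEssentiallyLocal cells X) (hY : IsEssentiallyLocal cells Y) :
    IsEssentiallyLocal cells (X + Y) := by
  intro a
  have : (X + Y) * cells.halfProj a - cells.halfProj a * (X + Y) =
      (X * cells.halfProj a - cells.halfProj a * X) +
        (Y * cells.halfProj a - cells.halfProj a * Y) := by noncomm_ring
  rw [this]
  exact (hX a).add (hY a)

theorem neg (hX : IsEssentiallyLocal cells X) : IsEssentiallyLocal cells (-X) := by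
  intro a
  have : -X * cells.halfProj a - cells.halfProj a * -X =
      -(X * cells.halfProj a - cells.halfProj a * X) := by noncomm_ring
  rw [this]
  exact (hX a).neg

theorem mul (hX : IsEssentiallyLocal cells X) (hY : IsEssentiallyLocal cells Y) :
    IsEssentiallyLocal cells (X * Y) := by
  intro a
  have : X * Y * cells.halfProj a - cells.halfProj a * (X * Y) =
      X * (Y * cells.halfProj a - cells.halfProj a * Y) +
        (X * cells.halfProj a - cells.halfProj a * X) * Y := by noncomm_ring
  rw [this]
  exact ((hY a).clm_comp X).add ((hX a).comp_clm Y)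

theorem smul (c : ℂ) (hX : IsEssentiallyLocal cells X) : IsEssentiallyLocal cells (c • X) := by
  intro a
  have : c • X * cells.halfProj a - cells.halfProj a * (c • X) =
      c • (X * cells.halfProj a - cells.halfProj a * X) := by
    rw [smul_mul_assoc, mul_smul_comm, smul_sub]
  rw [this]
  exact (hX a).smul c

/-- The identity `[X*, P] = -X* [X, P] X*` avoids the compactness of adjoints. -/
theorem star_of_unitary (hX : IsEssentiallyLocal cells X) (hu : X ∈ unitary (H →L[ℂ] H)) :
    IsEssentiallyLocal cells (star X) := by
  intro a
  obtain ⟨h1, h2⟩ := Unitary.mem_iff.mp hu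
  have : star X * cells.halfProj a - cells.halfProj a * star X =
      -(star X * (X * cells.halfProj a - cells.halfProj a * X) * star X) := by
    have e1 : star X * (X * cells.halfProj a - cells.halfProj a * X) * star X =
        star X * X * cells.halfProj a * star X - star X * cells.halfProj a * (X * star X) := by
      noncomm_ring
    rw [e1, h1, h2, one_mul, mul_one, neg_sub]
  rw [this]
  exact (((hX a).clm_comp (star X)).comp_clm (star X)).neg

theorem regroup (hX : IsEssentiallyLocal cells X) (c : ℤ → ℤ) (hc : StrictMono c) :
    IsEssentiallyLocal (cells.regroup c hc) X := by
  intro a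
  rw [cells.halfProj_regroup]
  exact hX (c a)

end IsEssentiallyLocal

theorem halfChainKernel_regroup (cells : CellStructure H) (c : ℤ → ℤ) (hc : StrictMono c)
    (γ W : H →L[ℂ] H) (a : ℤ) (ε : ℂ) :
    halfChainKernel (cells.regroup c hc) γ W a ε = halfChainKernel cells γ W (c a) ε := by
  unfold halfChainKernel
  rw [cells.halfProj_regroup, cells.halfChain_regroup]

end General

/-! ### Half-chain projections in coordinates and locality of the half-step -/

namespace SplitStep

theorem inner_single (x : ℤ) (v : Spin) (φ : Hilb) :
    inner ℂ (lp.lsingle (𝕜 := ℂ) (E := fun _ : ℤ => Spin) 2 x v) φ = inner ℂ v (φ x) :=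
  lp.inner_single_left _ _ _

theorem mem_halfChain_iff (b : ℤ) (φ : Hilb) :
    φ ∈ stdCells.halfChain b ↔ ∀ x < b, φ x = 0 := by
  constructor
  · intro h x hx
    have hle : stdCells.halfChain b ≤ (stdCells.cell x)ᗮ := by
      refine Submodule.topologicalClosure_minimal _ (iSup_le fun y => ?_)
        (Submodule.isClosed_orthogonal _)
      refine (stdCells.orthogonal y x ?_)
      have : b ≤ (y : ℤ) := y.2
      omega
    have h2 := (Submodule.mem_orthogonal _ _).mp (hle h) _ ⟨φ x, rfl⟩
    rw [inner_single] at h2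
    exact inner_self_eq_zero.mp h2
  · intro h
    have hs := lp.hasSum_single (E := fun _ : ℤ => Spin) (p := 2) (by simp) φ
    refine mem_closure_of_tendsto hs (Filter.Eventually.of_forall fun s => ?_)
    refine Submodule.sum_mem _ fun x _ => ?_
    by_cases hx : b ≤ x
    · exact Submodule.mem_iSup_of_mem (⟨x, hx⟩ : Set.Ici b) ⟨φ x, rfl⟩
    · rw [h x (not_le.mp hx)]
      simp

theorem halfProj_apply (b : ℤ) (φ : Hilb) (x : ℤ) :
    stdCells.halfProj b φ x = if b ≤ x then φ x else 0 := by
  split_ifs with hx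
  · have h1 : φ - stdCells.halfProj b φ ∈ (stdCells.halfChain b)ᗮ :=
      Submodule.sub_starProjection_mem_orthogonal φ
    have h2 := (Submodule.mem_orthogonal _ _).mp h1
      (lp.lsingle (𝕜 := ℂ) (E := fun _ : ℤ => Spin) 2 x ((φ - stdCells.halfProj b φ) x)) (by
        rw [mem_halfChain_iff]
        intro y hy
        exact lp.single_apply_ne _ _ _ (by omega))
    rw [inner_single] at h2
    have h3 : (φ - stdCells.halfProj b φ) x = 0 := inner_self_eq_zero.mp h2
    have h4 : φ x - stdCells.halfProj b φ x = 0 := h3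
    exact (sub_eq_zero.mp h4).symm
  · exact (mem_halfChain_iff b _).mp (Submodule.starProjection_apply_mem _ φ) x (not_le.mp hx)

theorem halfProj_apply_apply (b : ℤ) (φ : Hilb) (x : ℤ) (i : Fin 2) :
    stdCells.halfProj b φ x i = if b ≤ x then φ x i else 0 := by
  rw [halfProj_apply]
  split_ifs <;> rfl

theorem cellwise_mul_halfProj (M : Matrix (Fin 2) (Fin 2) ℂ) (b : ℤ) :
    cellwise M * stdCells.halfProj b = stdCells.halfProj b * cellwise M := by
  refine ContinuousLinearMap.ext fun φ => Hilb.ext fun x i => ?_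
  simp only [mul_apply_eq_comp, cellwise_apply, halfProj_apply_apply]
  split_ifs <;> simp

theorem isEssentiallyLocal_cellwise (M : Matrix (Fin 2) (Fin 2) ℂ) :
    IsEssentiallyLocal stdCells (cellwise M) :=
  .of_commute fun b => cellwise_mul_halfProj M b

theorem isEssentiallyLocal_translation_one : IsEssentiallyLocal stdCells (translation 1) := by
  intro b
  have := stdCells.finiteDimensional b
  -- Only the content of cell `b - 1` is carried across the cut, so the commutator takes values in
  -- the single cell `b`.
  refine isCompactOperator_of_forall_mem _ (stdCells.cell b) fun φ => ⟨-φ (b - 1), ?_⟩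
  refine Hilb.ext fun x i => ?_
  rw [sub_apply, Hilb.sub_apply]
  simp only [mul_apply_eq_comp, translation_apply, halfProj_apply_apply]
  show (lp.single (E := fun _ : ℤ => Spin) 2 b (-φ (b - 1))) x i = _
  rcases eq_or_ne x b with rfl | hx
  · rw [lp.single_apply_self]
    simp
  · rw [lp.single_apply_ne _ _ _ hx]
    by_cases h : b ≤ x
    · rw [if_pos h, if_pos (by omega)]
      simp
    · rw [if_neg h, if_neg (by omega)]
      simp

theorem isEssentiallyLocal_halfStep (θ : ℝ × ℝ) : IsEssentiallyLocal stdCells (halfStep θ) :=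
  ((isEssentiallyLocal_cellwise _).mul
    ((isEssentiallyLocal_translation_one.mul (isEssentiallyLocal_cellwise _)).add
      (isEssentiallyLocal_cellwise _))).mul (isEssentiallyLocal_cellwise _)

end SplitStep

/-! ### Isolated spectral points of normal operators -/

section General

variable {H : Type*} [NormedAddCommGroup H] [InnerProductSpace ℂ H] [CompleteSpace H]

/-- Continuity of this indicator on the spectrum lets the continuous functional calculus produce the
spectral projection at `z`. -/
theorem continuousOn_ite_eq_of_isolated {s : Set ℂ} {z : ℂ} (h : ∀ᶠ w in 𝓝[≠] z, w ∉ s) :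
    ContinuousOn (fun w : ℂ => if w = z then (1 : ℂ) else 0) s := by
  intro w hw
  by_cases hwz : w = z
  · subst hwz
    have h1 : ∀ᶠ u in 𝓝[s] w, u = w := by
      rw [eventually_nhdsWithin_iff] at h ⊢
      filter_upwards [h] with u hu hus
      by_contra hne
      exact hu hne hus
    refine ContinuousWithinAt.congr_of_eventuallyEq
      (f := fun _ => (1 : ℂ)) continuousWithinAt_const ?_ (by simp)
    filter_upwards [h1] with u hu
    simp [hu]
  · refine ContinuousWithinAt.congr_of_eventuallyEq
      (f := fun _ => (0 : ℂ)) continuousWithinAt_const ?_ (by simp [hwz])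
    refine Filter.Eventually.filter_mono nhdsWithin_le_nhds ?_
    filter_upwards [isOpen_ne.mem_nhds hwz] with u hu
    simp [show u ≠ z from hu]

theorem sub_smul_mul_cfc_ite_eq_zero (U : H →L[ℂ] H) [IsStarNormal U] {z : ℂ}
    (h : ∀ᶠ w in 𝓝[≠] z, w ∉ spectrum ℂ U) :
    (U - z • 1) * cfc (fun w : ℂ => if w = z then (1 : ℂ) else 0) U = 0 := by
  have hc := continuousOn_ite_eq_of_isolated h
  have h1 : U - z • 1 = cfc (fun w : ℂ => w - z) U := by
    rw [cfc_sub .., cfc_id' ℂ U, cfc_const z U, Algebra.algebraMap_eq_smul_one]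
  rw [h1, ← cfc_mul .., ← cfc_zero ℂ U]
  refine cfc_congr fun w _ => ?_
  by_cases hw : w = z <;> simp [hw]

/-- The spectral projection at `z` has 1 in its spectrum, hence is nonzero, and its range is
annihilated by `U - z`. -/
theorem exists_eigenvector_of_isolated (U : H →L[ℂ] H) [IsStarNormal U] {z : ℂ}
    (h : ∀ᶠ w in 𝓝[≠] z, w ∉ spectrum ℂ U) (hz : z ∈ spectrum ℂ U) :
    ∃ φ : H, φ ≠ 0 ∧ U φ = z • φ := by
  have hc := continuousOn_ite_eq_of_isolated h
  have hmem : (1 : ℂ) ∈ spectrum ℂ (cfc (fun w : ℂ => if w = z then (1 : ℂ) else 0) U) := by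
    rw [cfc_map_spectrum ..]
    exact ⟨z, hz, by simp⟩
  have hne : cfc (fun w : ℂ => if w = z then (1 : ℂ) else 0) U ≠ 0 := by
    intro h0
    rw [h0, spectrum.mem_iff, sub_zero, map_one] at hmem
    exact hmem isUnit_one
  obtain ⟨x, hx⟩ : ∃ x, cfc (fun w : ℂ => if w = z then (1 : ℂ) else 0) U x ≠ 0 := by
    by_contra! hcon
    exact hne (ContinuousLinearMap.ext hcon)
  refine ⟨_, hx, ?_⟩
  have h2 := congrArg (fun A : H →L[ℂ] H => A x) (sub_smul_mul_cfc_ite_eq_zero U h)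
  simpa [sub_eq_zero] using h2

end General

/-! ### The gap criterion for translation-invariant dispersion relations -/

namespace SplitStep

theorem tendsto_norm_cofinite (φ : Hilb) :
    Filter.Tendsto (fun x : ℤ => ‖φ x‖) Filter.cofinite (𝓝 0) := by
  have h : Summable fun x => ‖φ x‖ ^ (2 : ENNReal).toReal := (lp.memℓp φ).summable (by simp)
  have h2 := h.tendsto_cofinite_zero
  have h3 : Filter.Tendsto (fun x : ℤ => √(‖φ x‖ ^ (2 : ENNReal).toReal)) Filter.cofinite
      (𝓝 (√0)) := (Real.continuous_sqrt.tendsto 0).comp h2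
  rw [Real.sqrt_zero] at h3
  refine h3.congr fun x => ?_
  rw [ENNReal.toReal_ofNat, Real.rpow_ofNat, Real.sqrt_sq (norm_nonneg _)]

theorem tendsto_norm_atTop (φ : Hilb) (b : ℤ) :
    Filter.Tendsto (fun n : ℕ => ‖φ (b + n)‖) Filter.atTop (𝓝 0) := by
  rw [← Nat.cofinite_eq_atTop]
  refine (tendsto_norm_cofinite φ).comp (Function.Injective.tendsto_cofinite ?_)
  intro m n h
  simpa using h

theorem tendsto_norm_atBot (φ : Hilb) (b : ℤ) :
    Filter.Tendsto (fun n : ℕ => ‖φ (b - n)‖) Filter.atTop (𝓝 0) := by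
  rw [← Nat.cofinite_eq_atTop]
  refine (tendsto_norm_cofinite φ).comp (Function.Injective.tendsto_cofinite ?_)
  intro m n h
  simpa using h

theorem apply_eq_zero_of_norm_succ_eq (φ : Hilb) (b : ℤ)
    (h : ∀ x, b ≤ x → ‖φ (x + 1)‖ = ‖φ x‖) : φ b = 0 := by
  have hc : ∀ n : ℕ, ‖φ (b + n)‖ = ‖φ b‖ := by
    intro n
    induction n with
    | zero => simp
    | succ n ih =>
      rw [← ih, ← h (b + n) (by omega)]
      push_cast
      rw [add_assoc]
  have := tendsto_norm_atTop φ b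
  simp only [hc] at this
  exact norm_eq_zero.mp (tendsto_nhds_unique tendsto_const_nhds this)

theorem apply_eq_zero_of_norm_pred_eq (φ : Hilb) (b : ℤ)
    (h : ∀ x, x ≤ b → ‖φ (x - 1)‖ = ‖φ x‖) : φ b = 0 := by
  have hc : ∀ n : ℕ, ‖φ (b - n)‖ = ‖φ b‖ := by
    intro n
    induction n with
    | zero => simp
    | succ n ih =>
      rw [← ih, ← h (b - n) (by omega)]
      push_cast
      rw [sub_sub]
  have := tendsto_norm_atBot φ b
  simp only [hc] at this
  exact norm_eq_zero.mp (tendsto_nhds_unique tendsto_const_nhds this)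

/-- A preimage of a vector supported at 0 would have constant norm on each side of 0, hence vanish
on both sides by square-summability, leaving nothing to produce the source. -/
theorem not_isUnit_one_sub_smul_translation (σ : ℂ) (hσ : ‖σ‖ = 1) :
    ¬ IsUnit (1 - σ • translation 1 : Hilb →L[ℂ] Hilb) := by
  intro hu
  rw [ContinuousLinearMap.isUnit_iff_bijective] at hu
  let v : Spin := EuclideanSpace.single 0 1
  obtain ⟨φ, hφ⟩ := hu.2 (lp.single 2 0 v)
  have hx : ∀ x, φ x - σ • φ (x - 1) = lp.single (E := fun _ : ℤ => Spin) 2 0 v x := by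
    intro x
    rw [← hφ]
    rfl
  have h0 : ∀ x, x ≠ 0 → ‖φ x‖ = ‖φ (x - 1)‖ := by
    intro x hx0
    have h1 := hx x
    rw [lp.single_apply_ne _ _ _ hx0, sub_eq_zero] at h1
    rw [h1, norm_smul, hσ, one_mul]
  have h1 : φ 0 = 0 := apply_eq_zero_of_norm_succ_eq φ 0 fun x hx => by
    rw [h0 (x + 1) (by omega), add_sub_cancel_right]
  have h2 : φ (-1) = 0 := apply_eq_zero_of_norm_pred_eq φ (-1) fun x hx => by
    rw [h0 x (by omega)]
  have h3 := hx 0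
  rw [lp.single_apply_self, h1, zero_sub, zero_sub, h2] at h3
  have h4 : v 0 = 0 := by rw [← h3]; simp
  simp [v] at h4

theorem not_finiteDimensional_top : ¬ FiniteDimensional ℂ (⊤ : Submodule ℂ Hilb) := by
  intro h
  have h1 : FiniteDimensional ℂ Hilb := (Submodule.topEquiv (R := ℂ) (M := Hilb)).finiteDimensional
  let v : Spin := EuclideanSpace.single 0 1
  have hli : LinearIndependent ℂ (fun x : ℤ => (lp.single 2 x v : Hilb)) := by
    rw [linearIndependent_iff']
    intro s g hg x hx
    have h2 := congrArg (fun φ : Hilb => φ x 0) hg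
    have h3 : (∑ y ∈ s, g y • (lp.single 2 y v : Hilb)) x 0 = g x := by
      have e : ∀ t : Finset ℤ, (∑ y ∈ t, g y • (lp.single 2 y v : Hilb)) x 0 =
          ∑ y ∈ t, g y * (lp.single (E := fun _ : ℤ => Spin) 2 y v) x 0 := by
        intro t
        induction t using Finset.induction_on with
        | empty => simp
        | insert y t hy ih =>
          rw [Finset.sum_insert hy, Finset.sum_insert hy, Hilb.add_apply, ih, Hilb.smul_apply]
      rw [e, Finset.sum_eq_single x]
      · rw [lp.single_apply_self]
        simp [v]
      · intro y _ hy
        rw [lp.single_apply_ne _ _ _ (Ne.symm hy)]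
        simp
      · exact fun h => absurd hx h
    rw [← h3]
    exact h2
  exact Module.Finite.not_linearIndependent_of_infinite _ hli

instance : Nontrivial Hilb := by
  by_contra h
  rw [not_nontrivial_iff_subsingleton] at h
  exact not_finiteDimensional_top inferInstance

theorem norm_translation_le (n : ℤ) : ‖translation n‖ ≤ 1 :=
  ContinuousLinearMap.opNorm_le_bound _ zero_le_one fun φ => by
    rw [norm_translation_apply, one_mul]

theorem isUnit_of_isUnit_star_mul_self {A : Hilb →L[ℂ] Hilb} [IsStarNormal A]
    (h : IsUnit (star A * A)) : IsUnit A :=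
  ((star_comm_self (x := A)).isUnit_mul_iff.mp h).2

/-- If `|k| < a`, then `‖k(T + T⁻¹)‖ < 2a` and `U - z` is invertible. If `|k| = a ≠ 0`, then `|U -
z|²` is `a |1 - σT|²` with `σ` the sign of `k`, and `1 - σT` is injective but not invertible; thus
`z` lies in the spectrum without being an eigenvalue, and cannot be isolated. -/
theorem isEssentiallyGappedAt_iff (U : Hilb →L[ℂ] Hilb) [IsStarNormal U] (z : ℂ) (a k : ℝ)
    (hk : |k| ≤ a)
    (hU : star (U - z • 1) * (U - z • 1) =
      ((2 * a : ℝ) : ℂ) • 1 - (k : ℂ) • (translation 1 + translation (-1))) :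
    IsEssentiallyGappedAt U z ↔ |k| ≠ a := by
  have hn : IsStarNormal (U - z • 1) := by
    refine ⟨?_⟩
    have h := star_comm_self (x := U)
    simp only [Commute, SemiconjBy, star_sub, star_smul, star_one] at h ⊢
    simp only [sub_mul, mul_sub, smul_mul_assoc, mul_smul_comm, one_mul, mul_one, h]
    module
  have hspec : ∀ w : ℂ, w ∈ spectrum ℂ U ↔ ¬ IsUnit (U - w • 1) := by
    intro w
    rw [spectrum.mem_iff, Algebra.algebraMap_eq_smul_one, ← IsUnit.neg_iff, neg_sub]
  constructor
  · rintro ⟨hiso, hfin⟩ hka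
    -- In the flat case `a = k = 0` the operator is `U = z`: the point is isolated, but its
    -- eigenspace is all of the infinite-dimensional space.
    by_cases hk0 : k = 0
    · have ha : a = 0 := by rw [← hka, hk0, abs_zero]
      have h0 : star (U - z • 1) * (U - z • 1) = 0 := by
        rw [hU, ha, hk0]
        simp
      have h1 : U - z • 1 = 0 := (CStarRing.star_mul_self_eq_zero_iff _).mp h0
      have h2 : Module.End.eigenspace (U : Hilb →ₗ[ℂ] Hilb) z = ⊤ := by
        rw [eq_top_iff]
        intro φ _
        rw [Module.End.mem_eigenspace_iff]
        have h3 : (U - z • 1) φ = 0 := by rw [h1]; rfl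
        exact sub_eq_zero.mp h3
      rw [h2] at hfin
      exact not_finiteDimensional_top hfin
    · obtain ⟨σ, hσ, hσk⟩ : ∃ σ : ℝ, (σ = 1 ∨ σ = -1) ∧ k = σ * a := by
        rcases abs_cases k with ⟨h, _⟩ | ⟨h, _⟩
        · exact ⟨1, Or.inl rfl, by linarith⟩
        · exact ⟨-1, Or.inr rfl, by linarith⟩
      have ha : a ≠ 0 := by
        rintro rfl
        simp at hσk
        exact hk0 hσk
      have hσ2 : (σ : ℂ) * σ = 1 := by
        rcases hσ with rfl | rfl <;> simp
      have hσn : ‖(σ : ℂ)‖ = 1 := by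
        rcases hσ with rfl | rfl <;> simp
      have hfac : star (U - z • 1) * (U - z • 1) =
          (a : ℂ) • ((1 - (σ : ℂ) • translation (-1)) * (1 - (σ : ℂ) • translation 1)) := by
        rw [hU, hσk]
        simp only [sub_mul, mul_sub, smul_mul_assoc, mul_smul_comm, one_mul, mul_one,
          translation_mul, smul_sub, smul_smul, smul_add, hσ2]
        rw [show (-1 : ℤ) + 1 = 0 from rfl, translation_zero]
        push_cast
        module
      by_cases hz : z ∈ spectrum ℂ U
      · obtain ⟨φ, hφ, hUφ⟩ := exists_eigenvector_of_isolated U hiso hz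
        apply hφ
        have h1 : (U - z • 1) φ = 0 := by
          show U φ - z • φ = 0
          rw [hUφ, sub_self]
        have h2 : ((1 - (σ : ℂ) • translation (-1)) * (1 - (σ : ℂ) • translation 1)) φ = 0 := by
          have h3 : (star (U - z • 1) * (U - z • 1)) φ = 0 := by
            rw [mul_apply_eq_comp, h1, map_zero]
          rw [hfac] at h3
          exact (smul_eq_zero.mp h3).resolve_left (by exact_mod_cast ha)
        have h4 : (1 - (σ : ℂ) • translation 1) φ = 0 := by
          have e : 1 - (σ : ℂ) • translation (-1) = star (1 - (σ : ℂ) • translation 1) := by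
            rw [star_sub, star_smul, star_translation, star_one]
            simp
          rw [e] at h2
          have h5 := congrArg (fun ψ => inner ℂ ψ φ) h2
          simp only [mul_apply_eq_comp, ContinuousLinearMap.star_eq_adjoint,
            ContinuousLinearMap.adjoint_inner_left, inner_zero_left] at h5
          exact inner_self_eq_zero.mp h5
        have h5 : ∀ x, ‖φ x‖ = ‖φ (x - 1)‖ := by
          intro x
          have h6 : φ x - (σ : ℂ) • φ (x - 1) = 0 := congrArg (fun ψ : Hilb => ψ x) h4
          rw [sub_eq_zero.mp h6, norm_smul, hσn, one_mul]
        ext1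
        funext x
        refine apply_eq_zero_of_norm_succ_eq φ x fun y _ => ?_
        rw [h5 (y + 1), add_sub_cancel_right]
      · rw [hspec, not_not] at hz
        have h1 := hz.star.mul hz
        rw [hfac] at h1
        have hcomm : Commute (1 - (σ : ℂ) • translation (-1)) (1 - (σ : ℂ) • translation 1) := by
          simp only [Commute, SemiconjBy, sub_mul, mul_sub, smul_mul_assoc, mul_smul_comm, one_mul,
            mul_one, translation_mul]
          rw [show (-1 : ℤ) + 1 = 1 + -1 from rfl]
          module
        have h2 : IsUnit
            ((1 - (σ : ℂ) • translation (-1)) * (1 - (σ : ℂ) • translation 1)) := by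
          have : (a : ℂ) ≠ 0 := by exact_mod_cast ha
          exact (isUnit_smul_iff (Units.mk0 (a : ℂ) this) _).mp h1
        exact not_isUnit_one_sub_smul_translation σ hσn (hcomm.isUnit_mul_iff.mp h2).2
  · intro hne
    have hlt : |k| < a := lt_of_le_of_ne hk hne
    have hu : IsUnit (star (U - z • 1) * (U - z • 1)) := by
      rw [hU]
      have hmem : ((2 * a : ℝ) : ℂ) ∈
          resolventSet ℂ ((k : ℂ) • (translation 1 + translation (-1))) := by
        refine spectrum.mem_resolventSet_of_norm_lt ?_
        rw [norm_smul, Complex.norm_real, Complex.norm_real, Real.norm_eq_abs, Real.norm_eq_abs]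
        have h1 : ‖translation 1 + translation (-1)‖ ≤ 1 + 1 :=
          (norm_add_le _ _).trans (add_le_add (norm_translation_le 1) (norm_translation_le (-1)))
        have h2 : 0 ≤ |k| := abs_nonneg k
        rw [abs_of_pos (by linarith : 0 < 2 * a)]
        nlinarith
      rw [spectrum.mem_resolventSet_iff, Algebra.algebraMap_eq_smul_one] at hmem
      exact hmem
    have hz : z ∉ spectrum ℂ U := by
      rw [hspec, not_not]
      exact isUnit_of_isUnit_star_mul_self hu
    constructor
    · have ho : (spectrum ℂ U)ᶜ ∈ 𝓝 z := (spectrum.isClosed U).isOpen_compl.mem_nhds hz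
      exact Filter.Eventually.filter_mono nhdsWithin_le_nhds ho
    · have h1 : Module.End.eigenspace (U : Hilb →ₗ[ℂ] Hilb) z = ⊥ := by
        rw [eq_bot_iff]
        intro φ hφ
        rw [Module.End.mem_eigenspace_iff] at hφ
        rw [hspec, not_not, ContinuousLinearMap.isUnit_iff_bijective] at hz
        refine hz.1 ?_
        rw [map_zero]
        exact sub_eq_zero.mpr hφ
      rw [h1]
      infer_instance

/-- At `η = ±1` the previous criterion applies with `a = 1 + η sin t sin s` and `k = η cos t cos s`,
and `a² - k² = (sin t + η sin s)²`. -/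
theorem isEssentiallyGapped_iff (U : Hilb →L[ℂ] Hilb) (hU : U ∈ unitary (Hilb →L[ℂ] Hilb))
    (t s : ℝ)
    (h : U + star U = ((Real.cos t * Real.cos s : ℝ) : ℂ) • (translation 1 + translation (-1)) -
        ((2 * Real.sin t * Real.sin s : ℝ) : ℂ) • (1 : Hilb →L[ℂ] Hilb)) :
    IsEssentiallyGapped U ↔ |Real.sin t| ≠ |Real.sin s| := by
  obtain ⟨h1, h2⟩ := Unitary.mem_iff.mp hU
  have hn : IsStarNormal U := ⟨by rw [Commute, SemiconjBy, h1, h2]⟩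
  have hc1 := Real.sin_sq_add_cos_sq t
  have hc2 := Real.sin_sq_add_cos_sq s
  have hs1 := Real.abs_sin_le_one t
  have hs2 := Real.abs_sin_le_one s
  have hprod : |Real.sin t * Real.sin s| ≤ 1 := by
    rw [abs_mul]
    exact mul_le_one₀ hs1 (abs_nonneg _) hs2
  obtain ⟨hp1, hp2⟩ := abs_le.mp hprod
  have key : ∀ η : ℝ, η * η = 1 →
      (IsEssentiallyGappedAt U η ↔ Real.sin t + η * Real.sin s ≠ 0) := by
    intro η hη
    have hη' : η = 1 ∨ η = -1 := mul_self_eq_one_iff.mp hη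
    have hpos : 0 ≤ 1 + η * (Real.sin t * Real.sin s) := by
      rcases hη' with rfl | rfl <;> linarith
    have hsq : (1 + η * (Real.sin t * Real.sin s)) ^ 2 - (η * (Real.cos t * Real.cos s)) ^ 2 =
        (Real.sin t + η * Real.sin s) ^ 2 := by
      have e1 : Real.cos t ^ 2 = 1 - Real.sin t ^ 2 := by linarith
      have e2 : Real.cos s ^ 2 = 1 - Real.sin s ^ 2 := by linarith
      have e3 : (η * (Real.cos t * Real.cos s)) ^ 2 =
        (η * η) * (Real.cos t ^ 2 * Real.cos s ^ 2) := by ring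
      rw [e3, e1, e2]
      linear_combination (Real.sin t ^ 2 * Real.sin s ^ 2 - Real.sin s ^ 2 -
        (1 - Real.sin t ^ 2) * (1 - Real.sin s ^ 2)) * hη
    rw [isEssentiallyGappedAt_iff U η (1 + η * (Real.sin t * Real.sin s))
      (η * (Real.cos t * Real.cos s))]
    · have hiff : |η * (Real.cos t * Real.cos s)| = 1 + η * (Real.sin t * Real.sin s) ↔
          (η * (Real.cos t * Real.cos s)) ^ 2 = (1 + η * (Real.sin t * Real.sin s)) ^ 2 := by
        rw [sq_eq_sq_iff_abs_eq_abs, abs_of_nonneg hpos]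
      rw [Ne, Ne, not_iff_not, hiff]
      constructor
      · intro h
        have : (Real.sin t + η * Real.sin s) ^ 2 = 0 := by linarith
        exact pow_eq_zero_iff two_ne_zero |>.mp this
      · intro h
        rw [h] at hsq
        linarith
    · refine abs_le_of_sq_le_sq ?_ hpos
      nlinarith [sq_nonneg (Real.sin t + η * Real.sin s)]
    · have hηc : (η : ℂ) * η = 1 := by exact_mod_cast hη
      have e : star (U - (η : ℂ) • 1) * (U - (η : ℂ) • 1) =
          (2 : ℂ) • 1 - (η : ℂ) • (U + star U) := by
        simp only [star_sub, star_smul, star_one, sub_mul, mul_sub, smul_mul_assoc, mul_smul_comm,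
          one_mul, mul_one, h1, RCLike.star_def, Complex.conj_ofReal, smul_sub, smul_smul, hηc]
        module
      rw [e, h]
      push_cast
      module
  have k1 := key 1 (by norm_num)
  have k2 := key (-1) (by norm_num)
  rw [Complex.ofReal_one] at k1
  rw [Complex.ofReal_neg, Complex.ofReal_one] at k2
  rw [IsEssentiallyGapped, k1, k2, ← not_or, not_iff_not, abs_eq_abs]
  constructor
  · rintro (h | h)
    · right; linarith
    · left; linarith
  · rintro (h | h)
    · right; linarith
    · left; linarith

theorem walk_mem_unitary (θ : ℝ × ℝ) : walk θ ∈ unitary (Hilb →L[ℂ] Hilb) := by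
  rw [← timeframeW_halfStep, timeframeW]
  exact mul_mem (mul_mem (mul_mem chi_mem_unitary (Unitary.star_mem (halfStep_mem_unitary θ)))
    chi_mem_unitary) (halfStep_mem_unitary θ)

theorem translation_mul_halfStep (n : ℤ) (θ : ℝ × ℝ) :
    translation n * halfStep θ = halfStep θ * translation n := by
  have h : translation n * shiftUp = shiftUp * translation n := by
    refine ContinuousLinearMap.ext fun φ => Hilb.ext fun x i => ?_
    fin_cases i <;> simp [sub_right_comm]
  rw [halfStep, rot, rot, ← mul_assoc, ← mul_assoc, translation_mul_cellwise,
    mul_assoc (cellwise _),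
    h, mul_assoc, mul_assoc, translation_mul_cellwise, mul_assoc, mul_assoc]

theorem timeframeW'_mem_unitary (θ : ℝ × ℝ) :
    timeframeW' chi (halfStep θ) ∈ unitary (Hilb →L[ℂ] Hilb) :=
  mul_mem (mul_mem (mul_mem (halfStep_mem_unitary θ) chi_mem_unitary)
    (Unitary.star_mem (halfStep_mem_unitary θ))) chi_mem_unitary

theorem timeframeW'_eq_conj (θ : ℝ × ℝ) :
    timeframeW' chi (halfStep θ) = halfStep θ * walk θ * star (halfStep θ) := by
  rw [← timeframeW_halfStep, timeframeW, timeframeW']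
  simp only [mul_assoc]
  rw [(Unitary.mem_iff.mp (halfStep_mem_unitary θ)).2, mul_one]

/-- `W' = F W F*`, and `F` commutes with translations, so conjugation by `F` fixes the right-hand
side of the dispersion relation. -/
theorem timeframeW'_add_star (θ : ℝ × ℝ) :
    timeframeW' chi (halfStep θ) + star (timeframeW' chi (halfStep θ)) =
      ((Real.cos θ.1 * Real.cos θ.2 : ℝ) : ℂ) • (translation 1 + translation (-1)) -
        ((2 * Real.sin θ.1 * Real.sin θ.2 : ℝ) : ℂ) • (1 : Hilb →L[ℂ] Hilb) := by
  have h : timeframeW' chi (halfStep θ) + star (timeframeW' chi (halfStep θ)) =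
      halfStep θ * (walk θ + star (walk θ)) * star (halfStep θ) := by
    rw [timeframeW'_eq_conj, star_mul, star_mul, star_star]
    noncomm_ring
  have hu := (Unitary.mem_iff.mp (halfStep_mem_unitary θ)).2
  rw [h, walk_add_star_walk, mul_sub, mul_smul_comm, mul_smul_comm, mul_add,
    ← translation_mul_halfStep, ← translation_mul_halfStep, ← add_mul, mul_one, sub_mul,
    smul_mul_assoc, smul_mul_assoc, mul_assoc, hu, mul_one]

end SplitStep

/-! ### First-order recursions on the half-line -/

section Recursion

open Filter

/-- The norms `‖g x‖` are nondecreasing in `x` and tend to zero. -/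
theorem eq_zero_of_backward_recursion {u v : ℂ} (huv : ‖u‖ < ‖v‖) {g : ℤ → ℂ} {b : ℤ}
    (hg : Tendsto (fun n : ℕ => g (b + n)) atTop (𝓝 0))
    (h : ∀ x, b ≤ x → u * g (x + 1) + v * g x = 0) : ∀ x, b ≤ x → g x = 0 := by
  have hv : v ≠ 0 := norm_pos_iff.mp ((norm_nonneg u).trans_lt huv)
  have hle : ∀ x, b ≤ x → ‖g x‖ ≤ ‖g (x + 1)‖ := by
    intro x hx
    have h1 : v * g x = -(u * g (x + 1)) := by linear_combination h x hx
    have h2 : ‖v‖ * ‖g x‖ = ‖u‖ * ‖g (x + 1)‖ := by rw [← norm_mul, h1, norm_neg, norm_mul]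
    have h3 : ‖v‖ * ‖g x‖ ≤ ‖v‖ * ‖g (x + 1)‖ := by
      rw [h2]
      exact mul_le_mul_of_nonneg_right huv.le (norm_nonneg _)
    exact le_of_mul_le_mul_left h3 (norm_pos_iff.mpr hv)
  intro x hx
  obtain ⟨k, rfl⟩ := Int.le.dest hx
  have hmono : Monotone fun n : ℕ => ‖g (b + n)‖ := monotone_nat_of_le_succ fun n => by
    have := hle (b + n) (by omega)
    push_cast
    rwa [add_assoc] at this
  have h0 : Tendsto (fun n : ℕ => ‖g (b + n)‖) atTop (𝓝 0) := by simpa using hg.norm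
  exact norm_le_zero_iff.mp (hmono.ge_of_tendsto h0 k)

theorem eq_zero_of_forward_recursion {u v : ℂ} (hu : u ≠ 0) {g : ℤ → ℂ} {b : ℤ} (hb : g b = 0)
    (h : ∀ x, b ≤ x → u * g (x + 1) + v * g x = 0) : ∀ x, b ≤ x → g x = 0 := by
  intro x hx
  obtain ⟨k, rfl⟩ := Int.le.dest hx
  induction k with
  | zero => simpa using hb
  | succ k ih =>
    have h1 := h (b + k) (by omega)
    rw [ih (by omega), mul_zero, add_zero] at h1
    have := (mul_eq_zero.mp h1).resolve_left hu
    push_cast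
    rwa [← add_assoc]

theorem eq_zero_of_shift_combination {u v : ℂ} (huv : u ≠ 0 ∨ v ≠ 0) {f : ℤ → ℂ} {b : ℤ}
    (hb : ∀ x < b, f x = 0) (h : ∀ x, b ≤ x → u * f (x - 1) + v * f x = 0) : ∀ x, f x = 0 := by
  intro x
  rcases lt_or_ge x b with hx | hx
  · exact hb x hx
  -- For `v = 0` the operator is a pure shift, and `f x` is read off from the equation at `x + 1`.
  by_cases hv : v = 0
  · have h1 := h (x + 1) (by omega)
    rw [hv, zero_mul, add_zero, add_sub_cancel_right] at h1
    exact (mul_eq_zero.mp h1).resolve_left (huv.resolve_right (not_not.mpr hv))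
  · have h0 : f b = 0 := by
      have h1 := h b le_rfl
      rw [hb (b - 1) (by omega), mul_zero, zero_add] at h1
      exact (mul_eq_zero.mp h1).resolve_left hv
    refine eq_zero_of_forward_recursion hv h0 (v := u) (fun y hy => ?_) x hx
    have h1 := h (y + 1) (by omega)
    rw [add_sub_cancel_right] at h1
    linear_combination h1

/-- On generating functions the left side is multiplication by `uz + v`, which vanishes at `s =
-v/u` inside the unit disc. Evaluating the right side there gives `c / (1 - s r) = 0`. -/
theorem eq_zero_of_shift_combination_geometric {u v r : ℂ} (huv : ‖v‖ < ‖u‖) (hr : ‖r‖ < 1)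
    {f : ℤ → ℂ} {b : ℤ} (hb : ∀ x < b, f x = 0)
    (hf : Tendsto (fun n : ℕ => f (b + n)) atTop (𝓝 0)) {c : ℂ}
    (h : ∀ n : ℕ, u * f (b + n - 1) + v * f (b + n) = c * r ^ n) : c = 0 := by
  have hu : u ≠ 0 := norm_pos_iff.mp ((norm_nonneg v).trans_lt huv)
  set s : ℂ := -v / u with hs
  have hus : u * s = -v := by rw [hs]; field_simp
  have hs1 : ‖s‖ < 1 := by
    rw [hs, norm_div, norm_neg, div_lt_one (norm_pos_iff.mpr hu)]
    exact huv
  -- After weighting the `n`th equation by `s ^ n`, the relation `u s = -v` makes the sum telescope.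
  have htel : ∀ N : ℕ, ∑ n ∈ Finset.range (N + 1), c * (s * r) ^ n = v * s ^ N * f (b + N) := by
    intro N
    induction N with
    | zero =>
      have h0 := h 0
      rw [hb (b + (0 : ℕ) - 1) (by simp)] at h0
      simp only [zero_add, Finset.range_one, Finset.sum_singleton, pow_zero, mul_one] at h0 ⊢
      rw [← h0]
      ring
    | succ N ih =>
      rw [Finset.sum_range_succ, ih]
      have h1 := h (N + 1)
      rw [show b + ((N + 1 : ℕ) : ℤ) - 1 = b + N by push_cast; ring] at h1
      rw [mul_pow, mul_left_comm, ← h1, pow_succ]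
      linear_combination (s ^ N * f (b + N)) * hus
  have hsr : ‖s * r‖ < 1 := by
    rw [norm_mul]
    exact mul_lt_one_of_nonneg_of_lt_one_left (norm_nonneg _) hs1 hr.le
  have hl := ((hasSum_geometric_of_norm_lt_one hsr).mul_left c).tendsto_sum_nat.comp
    (tendsto_add_atTop_nat 1)
  have hz : Tendsto (fun N : ℕ => v * s ^ N * f (b + N)) atTop (𝓝 0) := by
    have h1 := ((tendsto_pow_atTop_nhds_zero_of_norm_lt_one hs1).const_mul v).mul hf
    simpa using h1
  have h2 := tendsto_nhds_unique hl (hz.congr fun N => (htel N).symm)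
  have h3 : (1 - s * r) ≠ 0 := by
    intro h0
    rw [← sub_eq_zero.mp h0, norm_one] at hsr
    exact lt_irrefl _ hsr
  exact (mul_eq_zero.mp h2).resolve_right (inv_ne_zero h3)

/-- The convolution of two geometric sequences solves the two-step recursion uniformly, with no
separate treatment of the double root `q = r`. -/
theorem summable_norm_geometric_convolution {q r : ℂ} (hq : ‖q‖ < 1) (hr : ‖r‖ < 1) :
    Summable fun n : ℕ => ‖∑ k ∈ Finset.HasAntidiagonal.antidiagonal n, q ^ k.1 * r ^ k.2‖ :=
  summable_norm_sum_mul_antidiagonal_of_summable_norm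
    (summable_norm_geometric_of_norm_lt_one hq) (summable_norm_geometric_of_norm_lt_one hr)

theorem geometric_convolution_succ (q r : ℂ) (n : ℕ) :
    ∑ k ∈ Finset.HasAntidiagonal.antidiagonal (n + 1), q ^ k.1 * r ^ k.2 =
      q * (∑ k ∈ Finset.HasAntidiagonal.antidiagonal n, q ^ k.1 * r ^ k.2) + r ^ (n + 1) := by
  rw [Finset.Nat.sum_antidiagonal_succ, Finset.mul_sum, pow_zero, one_mul, add_comm]
  congr 1
  refine Finset.sum_congr rfl fun k _ => ?_
  rw [pow_succ]
  ring

end Recursion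

/-! ### Half-chain kernels of factorised imaginary parts -/

namespace SplitStep

open Filter

theorem tendsto_apply_atTop (φ : Hilb) (b : ℤ) (i : Fin 2) :
    Tendsto (fun n : ℕ => φ (b + n) i) atTop (𝓝 0) := by
  rw [tendsto_zero_iff_norm_tendsto_zero]
  exact squeeze_zero (fun _ => norm_nonneg _) (fun n => PiLp.norm_apply_le (φ (b + n)) i)
    (tendsto_norm_atTop φ b)

theorem mem_halfChainKernel_iff (V : Hilb →L[ℂ] Hilb) (b : ℤ) (ε : ℂ) (hε : ε * ε = 1)
    (φ : Hilb) :
    φ ∈ halfChainKernel stdCells chi V b ε ↔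
      (∀ x < b, φ x = 0) ∧ (∀ x, φ x 1 = ε * φ x 0) ∧
        ∀ x, b ≤ x → ∀ i, (V - star V) φ x i = 0 := by
  unfold halfChainKernel
  rw [Submodule.mem_inf, Submodule.mem_inf, mem_halfChain_iff, and_assoc]
  refine and_congr_right fun hb => ?_
  have hP : stdCells.halfProj b φ = φ :=
    (stdCells.halfProj_apply_eq_self_iff b φ).mpr ((mem_halfChain_iff b φ).mpr hb)
  rw [and_comm]
  refine and_congr ?_ ?_
  · rw [Module.End.mem_eigenspace_iff]
    constructor
    · intro h x
      have := congrArg (fun ψ : Hilb => ψ x 0) h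
      simpa [Hilb.smul_apply] using this
    · intro h
      refine Hilb.ext fun x i => ?_
      show chi φ x i = _
      rw [Hilb.smul_apply]
      fin_cases i
      · simpa using h x
      · simp only [Fin.mk_one, chi_apply_one, h x]
        linear_combination -(φ x 0) * hε
  · rw [LinearMap.mem_ker]
    have h1 : (imPart (stdCells.halfProj b * V * stdCells.halfProj b) : Hilb →ₗ[ℂ] Hilb) φ =
        (2 * Complex.I)⁻¹ • stdCells.halfProj b ((V - star V) φ) := by
      show imPart (stdCells.halfProj b * V * stdCells.halfProj b) φ = _
      rw [imPart, smul_apply, star_mul, star_mul, stdCells.star_halfProj, sub_apply, sub_apply]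
      simp only [mul_apply_eq_comp, hP, map_sub]
    rw [h1, smul_eq_zero, or_iff_right (by simp)]
    constructor
    · intro h x hx i
      have := congrArg (fun ψ : Hilb => ψ x i) h
      simp only [halfProj_apply_apply, if_pos hx] at this
      exact this
    · intro h
      refine Hilb.ext fun x i => ?_
      rw [halfProj_apply_apply]
      split_ifs with hx
      · exact h x hx i
      · rfl

/-- On the `ε`-eigenspace of `γ` the operator `V - V*` acts as a nonzero multiple of the
composition of the adjoint of the first order translation-invariant operator with coefficients
`u', v'` and the one with coefficients `u, v`. -/
def ImFactors (V : Hilb →L[ℂ] Hilb) (ε u' v' u v : ℂ) : Prop :=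
  ∃ κ : ℂ, κ ≠ 0 ∧ ∀ φ : Hilb, (∀ x, φ x 1 = ε * φ x 0) → ∀ x,
    (V - star V) φ x 0 = κ * (u' * (u * φ x 0 + v * φ (x + 1) 0) +
      v' * (u * φ (x - 1) 0 + v * φ x 0)) ∧
    (V - star V) φ x 1 = -ε * (κ * (u' * (u * φ x 0 + v * φ (x + 1) 0) +
      v' * (u * φ (x - 1) 0 + v * φ x 0)))

namespace ImFactors

variable {V : Hilb →L[ℂ] Hilb} {ε u' v' u v : ℂ}

/-- The unsimplified `x + 1 - 1` makes the condition literally `u' * g (x + 1) + v' * g x = 0` for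
`g x = u * φ (x - 1) 0 + v * φ x 0`, the form of the first-order recursion lemmas. -/
theorem mem_halfChainKernel_iff (h : ImFactors V ε u' v' u v) (hε : ε * ε = 1) (b : ℤ)
    (φ : Hilb) :
    φ ∈ halfChainKernel stdCells chi V b ε ↔
      (∀ x < b, φ x = 0) ∧ (∀ x, φ x 1 = ε * φ x 0) ∧
        ∀ x, b ≤ x → u' * (u * φ (x + 1 - 1) 0 + v * φ (x + 1) 0) +
          v' * (u * φ (x - 1) 0 + v * φ x 0) = 0 := by
  rw [SplitStep.mem_halfChainKernel_iff V b ε hε]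
  obtain ⟨κ, hκ, hV⟩ := h
  refine and_congr_right fun _ => and_congr_right fun h1 => forall_congr' fun x =>
    imp_congr_right fun _ => ?_
  rw [add_sub_cancel_right, Fin.forall_fin_two, (hV φ h1 x).1, (hV φ h1 x).2]
  constructor
  · rintro ⟨h2, -⟩
    exact (mul_eq_zero.mp h2).resolve_left hκ
  · intro h2
    simp [h2]

theorem eq_zero_of_apply_zero (hφ : ∀ x, φ x 1 = ε * φ x 0) (h : ∀ x, φ x 0 = 0) :
    (φ : Hilb) = 0 := by
  refine Hilb.ext fun x i => ?_
  fin_cases i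
  · exact h x
  · show φ x 1 = 0
    rw [hφ x, h x, mul_zero]

theorem tendsto_combination (φ : Hilb) (b : ℤ) :
    Tendsto (fun n : ℕ => u * φ (b + n - 1) 0 + v * φ (b + n) 0) atTop (𝓝 0) := by
  have h1 := ((tendsto_apply_atTop φ (b - 1) 0).const_mul u).add
    ((tendsto_apply_atTop φ b 0).const_mul v)
  simp only [mul_zero, add_zero] at h1
  refine h1.congr fun n => ?_
  rw [sub_add_eq_add_sub]

/-- The outer recursion admits no decaying solution, and the inner factor is injective on the
half-line. -/
theorem halfChainKernel_eq_bot_of_lt (h : ImFactors V ε u' v' u v) (hε : ε * ε = 1)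
    (h' : ‖u'‖ < ‖v'‖) (huv : u ≠ 0 ∨ v ≠ 0) (b : ℤ) :
    halfChainKernel stdCells chi V b ε = ⊥ := by
  rw [eq_bot_iff]
  intro φ hφ
  obtain ⟨hb, he, hr⟩ := (h.mem_halfChainKernel_iff hε b φ).mp hφ
  refine eq_zero_of_apply_zero he (eq_zero_of_shift_combination huv (b := b)
    (fun x hx => by rw [hb x hx]; rfl) ?_)
  exact eq_zero_of_backward_recursion h' (g := fun x => u * φ (x - 1) 0 + v * φ x 0)
    (tendsto_combination φ b) hr

/-- The outer recursion leaves a decaying geometric sequence as source, but no decaying `φ` solves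
the inner equation for it unless the source vanishes. -/
theorem halfChainKernel_eq_bot_of_gt (h : ImFactors V ε u' v' u v) (hε : ε * ε = 1)
    (h' : ‖v'‖ < ‖u'‖) (huv : ‖v‖ < ‖u‖) (b : ℤ) :
    halfChainKernel stdCells chi V b ε = ⊥ := by
  rw [eq_bot_iff]
  intro φ hφ
  obtain ⟨hb, he, hr⟩ := (h.mem_halfChainKernel_iff hε b φ).mp hφ
  have hu' : u' ≠ 0 := norm_pos_iff.mp ((norm_nonneg v').trans_lt h')
  have hu : u ≠ 0 := norm_pos_iff.mp ((norm_nonneg v).trans_lt huv)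
  have hb0 : ∀ x < b, φ x 0 = 0 := fun x hx => by rw [hb x hx]; rfl
  have hgeo : ∀ n : ℕ, u * φ (b + n - 1) 0 + v * φ (b + n) 0 =
      (u * φ (b - 1) 0 + v * φ b 0) * (-v' / u') ^ n := by
    intro n
    induction n with
    | zero => simp
    | succ n ih =>
      have h1 := hr (b + n) (by omega)
      rw [pow_succ, ← mul_assoc, ← ih]
      push_cast
      rw [← add_assoc]
      field_simp
      linear_combination h1
  have hc := eq_zero_of_shift_combination_geometric huv (r := -v' / u')
    (by rwa [norm_div, norm_neg, div_lt_one (norm_pos_iff.mpr hu')]) hb0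
    (tendsto_apply_atTop φ b 0) hgeo
  refine eq_zero_of_apply_zero he (eq_zero_of_shift_combination
    (u := u) (v := v) (Or.inl hu) (b := b) hb0 ?_)
  exact eq_zero_of_forward_recursion hu' (g := fun x => u * φ (x - 1) 0 + v * φ x 0) hc hr

/-- Here the inner factor can be inverted by forward iteration with ratio `q = -u/v`. Applied to the
source `v * r ^ n` this gives the convolution `e` of `q ^ n` and `r ^ n`, which is absolutely
summable. -/
theorem exists_mem_halfChainKernel (h : ImFactors V ε u' v' u v) (hε : ε * ε = 1)
    (h' : ‖v'‖ < ‖u'‖) (huv : ‖u‖ < ‖v‖) (b : ℤ) :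
    ∃ φ ∈ halfChainKernel stdCells chi V b ε, φ ≠ 0 := by
  have hu' : u' ≠ 0 := norm_pos_iff.mp ((norm_nonneg v').trans_lt h')
  have hv : v ≠ 0 := norm_pos_iff.mp ((norm_nonneg u).trans_lt huv)
  set q : ℂ := -u / v with hq
  set r : ℂ := -v' / u' with hr
  have hq1 : ‖q‖ < 1 := by rwa [hq, norm_div, norm_neg, div_lt_one (norm_pos_iff.mpr hv)]
  have hr1 : ‖r‖ < 1 := by rwa [hr, norm_div, norm_neg, div_lt_one (norm_pos_iff.mpr hu')]
  let e : ℕ → ℂ := fun n => ∑ k ∈ Finset.HasAntidiagonal.antidiagonal n, q ^ k.1 * r ^ k.2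
  have he : Summable fun n => ‖e n‖ := summable_norm_geometric_convolution hq1 hr1
  have hes : ∀ n, e (n + 1) = q * e n + r ^ (n + 1) := geometric_convolution_succ q r
  let w : Spin := !₂[1, ε]
  let F : ℤ → Spin := fun x => if b ≤ x then e (x - b).toNat • w else 0
  have hF : Memℓp F 2 := by
    refine Memℓp.of_exponent_ge (q := 1) ?_ (by norm_num)
    refine memℓp_gen ?_
    simp only [ENNReal.toReal_one, Real.rpow_one]
    have hinj : Function.Injective fun n : ℕ => b + (n : ℤ) := fun m n hmn => by simpa using hmn
    refine (hinj.summable_iff fun x hx => ?_).mp ?_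
    · have : ¬ b ≤ x := fun hbx => hx ⟨(x - b).toNat, by simp; omega⟩
      simp [F, this]
    · refine (he.mul_right ‖w‖).congr fun n => ?_
      simp [F, norm_smul]
  let φ : Hilb := ⟨F, hF⟩
  have hφ0 : ∀ x, φ x 0 = if b ≤ x then e (x - b).toNat else 0 := by
    intro x
    show F x 0 = _
    by_cases hx : b ≤ x <;> simp [F, hx, w]
  have hφn : ∀ n : ℕ, φ (b + n) 0 = e n := by
    intro n
    rw [hφ0, if_pos (by omega)]
    simp
  have hg : ∀ n : ℕ, u * φ (b + n - 1) 0 + v * φ (b + n) 0 = v * r ^ n := by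
    intro n
    rcases n with _ | n
    · rw [hφ0 (b + (0 : ℕ) - 1), if_neg (by simp), hφn]
      simp [e]
    · rw [show b + ((n + 1 : ℕ) : ℤ) - 1 = b + n by push_cast; ring, hφn, hφn, hes]
      have : v * q = -u := by rw [hq]; field_simp
      linear_combination e n * this
  refine ⟨φ, (h.mem_halfChainKernel_iff hε b φ).mpr ⟨?_, ?_, ?_⟩, ?_⟩
  · intro x hx
    exact if_neg (not_le.mpr hx)
  · intro x
    show F x 1 = ε * F x 0
    by_cases hx : b ≤ x <;> simp [F, hx, w, mul_comm]
  · intro x hx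
    obtain ⟨n, rfl⟩ := Int.le.dest hx
    have h1 := hg (n + 1)
    push_cast at h1
    rw [← add_assoc] at h1
    rw [h1, hg n, pow_succ]
    have : u' * r = -v' := by rw [hr]; field_simp
    linear_combination v * r ^ n * this
  · intro h0
    have h1 := hφn 0
    rw [h0] at h1
    simp [e] at h1

theorem finrank_halfChainKernel_eq_one (h : ImFactors V ε u' v' u v) (hε : ε * ε = 1)
    (h' : ‖v'‖ < ‖u'‖) (huv : ‖u‖ < ‖v‖) (b : ℤ) :
    FiniteDimensional ℂ (halfChainKernel stdCells chi V b ε) ∧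
      Module.finrank ℂ (halfChainKernel stdCells chi V b ε) = 1 := by
  have hu' : u' ≠ 0 := norm_pos_iff.mp ((norm_nonneg v').trans_lt h')
  have hv : v ≠ 0 := norm_pos_iff.mp ((norm_nonneg u).trans_lt huv)
  -- The boundary value at `b` determines the initial value of the outer recursion, hence the whole
  -- solution; the dimension is at most one.
  let ev : halfChainKernel stdCells chi V b ε →ₗ[ℂ] ℂ :=
    { toFun := fun φ => (φ : Hilb) b 0
      map_add' := fun _ _ => rfl
      map_smul' := fun _ _ => rfl }
  have hinj : Function.Injective ev := by
    rw [injective_iff_map_eq_zero]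
    rintro ⟨φ, hφ⟩ h0
    obtain ⟨hb, he, hr⟩ := (h.mem_halfChainKernel_iff hε b φ).mp hφ
    have h0' : φ b 0 = 0 := h0
    have hb0 : ∀ x < b, φ x 0 = 0 := fun x hx => by rw [hb x hx]; rfl
    refine Subtype.ext (eq_zero_of_apply_zero he
      (eq_zero_of_shift_combination (u := u) (v := v) (Or.inr hv) (b := b) hb0 ?_))
    refine eq_zero_of_forward_recursion hu' (g := fun x => u * φ (x - 1) 0 + v * φ x 0) ?_ hr
    simp [h0', hb0 (b - 1) (by omega)]
  have hfin : FiniteDimensional ℂ (halfChainKernel stdCells chi V b ε) :=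
    FiniteDimensional.of_injective ev hinj
  refine ⟨hfin, le_antisymm ?_ ?_⟩
  · simpa using LinearMap.finrank_le_finrank_of_injective hinj
  · obtain ⟨φ, hφ, hne⟩ := h.exists_mem_halfChainKernel hε h' huv b
    have : Nontrivial (halfChainKernel stdCells chi V b ε) :=
      ⟨⟨φ, hφ⟩, 0, fun h0 => hne (congrArg Subtype.val h0)⟩
    exact Module.finrank_pos

end ImFactors

/-! ### The factors for the split-step walk -/

section Factors

/-- `cos (t / 2) + sin (t / 2)`, a square root of `1 + sin t`. -/
def cp (t : ℝ) : ℝ := Real.cos (t / 2) + Real.sin (t / 2)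

/-- `cos (t / 2) - sin (t / 2)`, a square root of `1 - sin t`. -/
def cm (t : ℝ) : ℝ := Real.cos (t / 2) - Real.sin (t / 2)

theorem cp_sq (t : ℝ) : cp t ^ 2 = 1 + Real.sin t := by
  have hs : Real.sin t = 2 * Real.sin (t / 2) * Real.cos (t / 2) := by
    rw [← Real.sin_two_mul, mul_div_cancel₀ _ two_ne_zero]
  rw [cp, hs]
  linear_combination Real.sin_sq_add_cos_sq (t / 2)

theorem cm_sq (t : ℝ) : cm t ^ 2 = 1 - Real.sin t := by
  have hs : Real.sin t = 2 * Real.sin (t / 2) * Real.cos (t / 2) := by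
    rw [← Real.sin_two_mul, mul_div_cancel₀ _ two_ne_zero]
  rw [cm, hs]
  linear_combination Real.sin_sq_add_cos_sq (t / 2)

theorem timeframeW_sub_star (F : Hilb →L[ℂ] Hilb) :
    timeframeW chi F - star (timeframeW chi F) =
      chi * star F * chi * F - star F * chi * F * chi := by
  simp only [timeframeW, star_mul, star_chi, star_star, mul_assoc]

theorem timeframeW'_sub_star (F : Hilb →L[ℂ] Hilb) :
    timeframeW' chi F - star (timeframeW' chi F) =
      F * chi * star F * chi - chi * F * chi * star F := by
  simp only [timeframeW', star_mul, star_chi, star_star, mul_assoc]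

/-- The pair `u, v` comes from the block `A` of `F` and `u', v'` from the block `B`; they trade
places on `γ = -1`. For `W'` the block `C` replaces `B`. -/
theorem imFactors_timeframeW_one (θ : ℝ × ℝ) :
    ImFactors (timeframeW chi (halfStep θ)) 1 (cp θ.2 * cp θ.1 : ℝ) (-(cm θ.2 * cm θ.1) : ℝ)
      (cp θ.2 * cm θ.1 : ℝ) (cm θ.2 * cp θ.1 : ℝ) := by
  refine ⟨-1, by norm_num, fun φ hφ x => ?_⟩
  rw [timeframeW_sub_star, star_halfStep, halfStep, sub_apply, Hilb.sub_apply, Hilb.sub_apply]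
  constructor <;>
  · simp [hφ, cp, cm, -Complex.ofReal_cos, -Complex.ofReal_sin]
    ring

theorem imFactors_timeframeW_neg_one (θ : ℝ × ℝ) :
    ImFactors (timeframeW chi (halfStep θ)) (-1) (cp θ.2 * cm θ.1 : ℝ) (cm θ.2 * cp θ.1 : ℝ)
      (cp θ.2 * cp θ.1 : ℝ) (-(cm θ.2 * cm θ.1) : ℝ) := by
  refine ⟨1, by norm_num, fun φ hφ x => ?_⟩
  rw [timeframeW_sub_star, star_halfStep, halfStep, sub_apply, Hilb.sub_apply, Hilb.sub_apply]
  constructor <;>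
  · simp [hφ, cp, cm, -Complex.ofReal_cos, -Complex.ofReal_sin]
    ring

theorem imFactors_timeframeW'_one (θ : ℝ × ℝ) :
    ImFactors (timeframeW' chi (halfStep θ)) 1 (cp θ.2 * cm θ.1 : ℝ) (cm θ.2 * cp θ.1 : ℝ)
      (cm θ.2 * cm θ.1 : ℝ) (-(cp θ.2 * cp θ.1) : ℝ) := by
  refine ⟨1, by norm_num, fun φ hφ x => ?_⟩
  rw [timeframeW'_sub_star, star_halfStep, halfStep, sub_apply, Hilb.sub_apply, Hilb.sub_apply]
  constructor <;>
  · simp [hφ, cp, cm, -Complex.ofReal_cos, -Complex.ofReal_sin]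
    ring

theorem imFactors_timeframeW'_neg_one (θ : ℝ × ℝ) :
    ImFactors (timeframeW' chi (halfStep θ)) (-1) (cm θ.2 * cm θ.1 : ℝ)
      (-(cp θ.2 * cp θ.1) : ℝ) (cp θ.2 * cm θ.1 : ℝ) (cm θ.2 * cp θ.1 : ℝ) := by
  refine ⟨-1, by norm_num, fun φ hφ x => ?_⟩
  rw [timeframeW'_sub_star, star_halfStep, halfStep, sub_apply, Hilb.sub_apply, Hilb.sub_apply]
  constructor <;>
  · simp [hφ, cp, cm, -Complex.ofReal_cos, -Complex.ofReal_sin]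
    ring

end Factors

end SplitStep

/-! ### Graded kernels of self-adjoint Fredholm operators -/

section Fredholm

variable {H : Type*} [NormedAddCommGroup H] [InnerProductSpace ℂ H]

open Filter in
-- Otherwise there are unit vectors with `T (x n) → 0`. Compactness of `B * T - 1` makes a
-- subsequence of them converge, to a unit vector in the kernel of `T`.
theorem exists_antilipschitzWith_of_leftInverse_mod_compact (T B : H →L[ℂ] H)
    (hB : IsCompactOperator (B * T - 1 : H →L[ℂ] H)) (hT : Function.Injective T) :
    ∃ K, AntilipschitzWith K T := by
  rw [antilipschitzWith_iff_exists_mul_le_norm]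
  by_contra! hcon
  have hseq : ∀ n : ℕ, ∃ x : H, ‖x‖ = 1 ∧ ‖T x‖ < 1 / ((n : ℝ) + 1) := by
    intro n
    obtain ⟨x, hx⟩ := hcon (1 / ((n : ℝ) + 1)) (by positivity)
    have hx0 : x ≠ 0 := by
      rintro rfl
      simp at hx
    have hn : 0 < ‖x‖ := norm_pos_iff.mpr hx0
    refine ⟨((‖x‖⁻¹ : ℝ) : ℂ) • x, ?_, ?_⟩
    · rw [norm_smul, Complex.norm_real, norm_inv, norm_norm, inv_mul_cancel₀ hn.ne']
    · rw [map_smul, norm_smul, Complex.norm_real, norm_inv, norm_norm, inv_mul_lt_iff₀ hn, mul_comm]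
      exact hx
  choose x hx1 hx2 using hseq
  have hTx : Tendsto (fun n => T (x n)) atTop (𝓝 0) :=
    squeeze_zero_norm (fun n => (hx2 n).le) tendsto_one_div_add_atTop_nhds_zero_nat
  obtain ⟨C, hC, hsub⟩ := hB.image_closedBall_subset_compact 1
  obtain ⟨y, -, ψ, hψ, hy⟩ := hC.tendsto_subseq
    (x := fun n => (B * T - 1) (x n)) (fun n => hsub ⟨x n, by simp [hx1], rfl⟩)
  have hBT : Tendsto (fun n => B (T (x (ψ n)))) atTop (𝓝 0) := by
    have := (B.continuous.tendsto 0).comp (hTx.comp hψ.tendsto_atTop)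
    rwa [map_zero] at this
  have hxy : Tendsto (fun n => x (ψ n)) atTop (𝓝 (-y)) := by
    have h1 := hBT.sub hy
    rw [zero_sub] at h1
    refine h1.congr fun n => ?_
    simp
  have hy1 : ‖-y‖ = 1 :=
    tendsto_nhds_unique hxy.norm (by simp [hx1])
  have hTy : T (-y) = 0 :=
    tendsto_nhds_unique ((T.continuous.tendsto _).comp hxy) (hTx.comp hψ.tendsto_atTop)
  have : -y = 0 := hT (by rw [hTy, map_zero])
  rw [this, norm_zero] at hy1
  exact zero_ne_one hy1

/-- The compact operator `B * T - 1` acts as `-1` on the kernel of `T`. -/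
theorem finiteDimensional_ker_of_leftInverse_mod_compact (T B : H →L[ℂ] H)
    (hB : IsCompactOperator (B * T - 1 : H →L[ℂ] H)) :
    FiniteDimensional ℂ (LinearMap.ker (T : H →ₗ[ℂ] H)) := by
  have hV : ∀ v ∈ LinearMap.ker (T : H →ₗ[ℂ] H),
      ((B * T - 1 : H →L[ℂ] H) : H →ₗ[ℂ] H) v ∈ LinearMap.ker (T : H →ₗ[ℂ] H) := by
    intro v hv
    have hv' : T v = 0 := hv
    have : (B * T - 1) v = -v := by simp [hv']
    show (B * T - 1) v ∈ LinearMap.ker (T : H →ₗ[ℂ] H)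
    rw [this]
    exact neg_mem hv
  have h1 := IsCompactOperator.restrict
    (f := ((B * T - 1 : H →L[ℂ] H) : H →ₗ[ℂ] H)) hB hV T.isClosed_ker
  have h2 := h1.neg
  refine FiniteDimensional.of_isCompactOperator_id (𝕜 := ℂ) ?_
  convert! h2 using 1
  funext v
  refine Subtype.ext ?_
  have hv' : T v = 0 := v.2
  show (v : H) = -((B * T - 1) (v : H))
  simp [hv']

theorem finrank_map_add_finrank_inf_ker (p : Submodule ℂ H) [FiniteDimensional ℂ p]
    (f : H →ₗ[ℂ] H) :
    Module.finrank ℂ (p.map f) + Module.finrank ℂ (p ⊓ LinearMap.ker f : Submodule ℂ H) =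
      Module.finrank ℂ p := by
  have h := LinearMap.finrank_range_add_finrank_ker (f.domRestrict p)
  have h1 : LinearMap.range (f.domRestrict p) = p.map f := by
    rw [LinearMap.domRestrict, LinearMap.range_comp, Submodule.range_subtype]
  have h2 : (LinearMap.ker (f.domRestrict p)).map p.subtype = p ⊓ LinearMap.ker f := by
    rw [LinearMap.domRestrict, LinearMap.ker_comp, Submodule.map_comap_subtype]
  rw [h1] at h
  rw [← h2, LinearEquiv.finrank_eq
    (Submodule.equivMapOfInjective p.subtype p.injective_subtype _).symm]
  exact h

variable [CompleteSpace H]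

theorem isUnit_of_isSelfAdjoint_of_antilipschitzWith {T : H →L[ℂ] H} (hT : star T = T) {K : NNReal}
    (hK : AntilipschitzWith K T) : IsUnit T := by
  rw [ContinuousLinearMap.isUnit_iff_bijective,
    ContinuousLinearMap.bijective_iff_dense_range_and_antilipschitz]
  refine ⟨?_, K, hK⟩
  rw [Submodule.topologicalClosure_eq_top_iff, ContinuousLinearMap.orthogonal_range,
    ← ContinuousLinearMap.star_eq_adjoint, hT]
  exact LinearMap.ker_eq_bot.mpr hK.injective

/-- Kernel and range of a self-adjoint operator are orthogonal, so `Q + A` is injective. It inherits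
the left inverse of `A` modulo compacts, since `Q` has finite rank. -/
theorem isUnit_starProjection_ker_add (A B : H →L[ℂ] H) (hA : star A = A)
    (hB : IsCompactOperator (B * A - 1 : H →L[ℂ] H))
    [FiniteDimensional ℂ (LinearMap.ker (A : H →ₗ[ℂ] H))] :
    IsUnit ((LinearMap.ker (A : H →ₗ[ℂ] H)).starProjection + A) := by
  set N := LinearMap.ker (A : H →ₗ[ℂ] H) with hN
  set Q := N.starProjection with hQ
  have hinj : Function.Injective (Q + A) := by
    rw [injective_iff_map_eq_zero]
    intro x hx
    have h1 : A x = -Q x := by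
      rw [eq_neg_iff_add_eq_zero, add_comm]
      exact hx
    have h2 : A (Q x) = 0 := N.starProjection_apply_mem x
    have h3 : A x = 0 := by
      have h4 : inner ℂ (A x) (A x) = 0 := by
        nth_rewrite 2 [h1]
        rw [inner_neg_right, ← ContinuousLinearMap.adjoint_inner_right,
          ← ContinuousLinearMap.star_eq_adjoint, hA, h2, inner_zero_right, neg_zero]
      exact inner_self_eq_zero.mp h4
    have h5 : Q x = x := Submodule.starProjection_eq_self_iff.mpr h3
    rw [← h5, ← neg_eq_zero, ← h1, h3]
  have hcomp : IsCompactOperator (B * (Q + A) - 1 : H →L[ℂ] H) := by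
    have e : B * (Q + A) - 1 = B * Q + (B * A - 1) := by noncomm_ring
    rw [e]
    exact ((isCompactOperator_of_forall_mem Q N N.starProjection_apply_mem).clm_comp B).add hB
  obtain ⟨K, hK⟩ := exists_antilipschitzWith_of_leftInverse_mod_compact (Q + A) B hcomp hinj
  refine isUnit_of_isSelfAdjoint_of_antilipschitzWith ?_ hK
  rw [star_add, hA, isSelfAdjoint_starProjection]

/-- The `ε`-eigenvectors of `γ` in the kernel of `A`. -/
def gradedKer (γ A : H →L[ℂ] H) (ε : ℂ) : Submodule ℂ H :=
  LinearMap.ker (A : H →ₗ[ℂ] H) ⊓ Module.End.eigenspace (γ : H →ₗ[ℂ] H) ε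

/-- The Schur complement argument: the graded kernel of an operator `A` anticommuting with `γ` has
the same index as a finite-dimensional `γ`-invariant subspace on whose complement `A` is
invertible. -/
theorem finrank_gradedKer_add_eq (A γ : H →L[ℂ] H) (N : Submodule ℂ H) [FiniteDimensional ℂ N]
    (hA : star A = A) (hγA : γ * A = -(A * γ))
    (hγN : γ * N.starProjection = N.starProjection * γ)
    (hL : IsUnit (N.starProjection + (1 - N.starProjection) * A)) :
    Module.finrank ℂ (gradedKer γ A 1) +
        Module.finrank ℂ (N ⊓ Module.End.eigenspace (γ : H →ₗ[ℂ] H) (-1) : Submodule ℂ H) =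
      Module.finrank ℂ (gradedKer γ A (-1)) +
        Module.finrank ℂ (N ⊓ Module.End.eigenspace (γ : H →ₗ[ℂ] H) 1 : Submodule ℂ H) := by
  set Q := N.starProjection with hQ
  obtain ⟨L, hL⟩ := hL
  have hLx : ∀ x, (L : H →L[ℂ] H) x = Q x + (A x - Q (A x)) := fun x => by rw [hL]; rfl
  set R : H →L[ℂ] H := ↑L⁻¹ with hR
  have hLR : ∀ x, (L : H →L[ℂ] H) (R x) = x := fun x =>
    congrArg (fun T : H →L[ℂ] H => T x) L.mul_inv
  have hRL : ∀ x, R ((L : H →L[ℂ] H) x) = x := fun x =>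
    congrArg (fun T : H →L[ℂ] H => T x) L.inv_mul
  have hLinj : Function.Injective (L : H →L[ℂ] H) := fun x y h => by rw [← hRL x, h, hRL]
  have hRinj : Function.Injective R := fun x y h => by rw [← hLR x, h, hLR]
  have hQQ : ∀ x, Q (Q x) = Q x := fun x =>
    Submodule.starProjection_eq_self_iff.mpr (N.starProjection_apply_mem x)
  have hQN : ∀ x, Q x = x ↔ x ∈ N := fun x => Submodule.starProjection_eq_self_iff
  -- `R` identifies `N` with the vectors that `A` sends into `N`, the inverse being `Q`. The kernel
  -- of `A` thus corresponds to the kernel of the Schur complement `A R` on `N`.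
  have hQR : ∀ n ∈ N, Q (R n) = n := by
    intro n hn
    have h1 := congrArg Q (hLR n)
    rw [hLx, (hQN n).mpr hn, map_add, map_sub, hQQ, hQQ, sub_self, add_zero] at h1
    exact h1
  have hAR : ∀ n ∈ N, A (R n) ∈ N := by
    intro n hn
    have h1 := hLR n
    rw [hLx, hQR n hn, add_eq_left, sub_eq_zero] at h1
    exact (hQN _).mp h1.symm
  have hLQ : ∀ x, A x ∈ N → (L : H →L[ℂ] H) x = Q x := by
    intro x hx
    rw [hLx, (hQN _).mpr hx, sub_self, add_zero]
  have hγA' : ∀ x, γ (A x) = -A (γ x) := fun x => congrArg (fun T : H →L[ℂ] H => T x) hγA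
  have hγQ' : ∀ x, γ (Q x) = Q (γ x) := fun x => congrArg (fun T : H →L[ℂ] H => T x) hγN
  have hsym : ∀ x y, inner ℂ (A x) y = inner ℂ x (A y) := fun x y => by
    rw [← ContinuousLinearMap.adjoint_inner_right, ← ContinuousLinearMap.star_eq_adjoint, hA]
  have hQsym : ∀ x y, inner ℂ (Q x) y = inner ℂ x (Q y) := N.inner_starProjection_left_eq_right
  have hmem : ∀ (ε : ℂ) (x : H),
      x ∈ Module.End.eigenspace (γ : H →ₗ[ℂ] H) ε ↔ γ x = ε • x := fun ε x =>
    Module.End.mem_eigenspace_iff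
  have hγN' : ∀ x ∈ N, γ x ∈ N := fun x hx => by
    rw [← hQN, ← hγQ', (hQN x).mpr hx]
  have hRγ : ∀ (ε : ℂ), ∀ n ∈ N, γ n = ε • n → γ (R n) = ε • R n := by
    intro ε n hn hε
    apply hLinj
    rw [map_smul, hLR, ← hε, hLQ, ← hγQ', hQR n hn]
    rw [← neg_neg (A (γ (R n))), ← hγA']
    exact neg_mem (hγN' _ (hAR n hn))
  set Np := N ⊓ Module.End.eigenspace (γ : H →ₗ[ℂ] H) 1 with hNp
  set Nm := N ⊓ Module.End.eigenspace (γ : H →ₗ[ℂ] H) (-1) with hNm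
  have : FiniteDimensional ℂ Np := Submodule.finiteDimensional_of_le (inf_le_left : Np ≤ N)
  have : FiniteDimensional ℂ Nm := Submodule.finiteDimensional_of_le (inf_le_left : Nm ≤ N)
  -- The Schur complement is odd, so it maps the even part of `N` into the odd part. Being also
  -- self-adjoint on `N`, its odd kernel is the orthogonal complement of `I` in the odd part, and
  -- the dimension of `I` cancels from the two rank counts.
  set I := Np.map ((A * R : H →L[ℂ] H) : H →ₗ[ℂ] H) with hI
  have hI_le : I ≤ Nm := by
    rintro _ ⟨n, ⟨hn, hn1⟩, rfl⟩
    rw [SetLike.mem_coe, hmem] at hn1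
    refine ⟨hAR n hn, ?_⟩
    rw [SetLike.mem_coe, hmem]
    show γ (A (R n)) = (-1 : ℂ) • A (R n)
    rw [hγA', hRγ 1 n hn hn1, one_smul, neg_one_smul]
  have hplus : Module.finrank ℂ (Np ⊓ LinearMap.ker ((A * R : H →L[ℂ] H) : H →ₗ[ℂ] H) :
      Submodule ℂ H) = Module.finrank ℂ (gradedKer γ A 1) := by
    have e : (Np ⊓ LinearMap.ker ((A * R : H →L[ℂ] H) : H →ₗ[ℂ] H)).map (R : H →ₗ[ℂ] H) =
        gradedKer γ A 1 := by
      apply le_antisymm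
      · rintro _ ⟨n, ⟨⟨hn, hn1⟩, hn2⟩, rfl⟩
        rw [SetLike.mem_coe, hmem] at hn1
        refine ⟨hn2, ?_⟩
        rw [SetLike.mem_coe, hmem]
        exact hRγ 1 n hn hn1
      · rintro x ⟨hx1, hx2⟩
        rw [SetLike.mem_coe, hmem] at hx2
        have hx0 : A x = 0 := hx1
        have hLx' : (L : H →L[ℂ] H) x = Q x := hLQ x (by rw [hx0]; exact zero_mem N)
        have hRQ : R (Q x) = x := by rw [← hLx', hRL]
        refine ⟨Q x, ⟨⟨N.starProjection_apply_mem x, ?_⟩, ?_⟩, hRQ⟩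
        · rw [SetLike.mem_coe, hmem, hγQ', hx2, map_smul]
        · show A (R (Q x)) = 0
          rw [hRQ, hx0]
    rw [← e]
    exact LinearEquiv.finrank_eq (Submodule.equivMapOfInjective (R : H →ₗ[ℂ] H) hRinj _)
  have hminus : Module.finrank ℂ (Iᗮ ⊓ Nm : Submodule ℂ H) =
      Module.finrank ℂ (gradedKer γ A (-1)) := by
    have e : (Iᗮ ⊓ Nm).map (R : H →ₗ[ℂ] H) = gradedKer γ A (-1) := by
      apply le_antisymm
      · rintro _ ⟨n, ⟨hnI, hn, hn1⟩, rfl⟩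
        rw [SetLike.mem_coe, hmem] at hn1
        have hγR := hRγ (-1) n hn hn1
        refine ⟨?_, ?_⟩
        · show A (R n) = 0
          have hAN := hAR n hn
          have hAp : A (R n) ∈ Np := by
            refine ⟨hAN, ?_⟩
            rw [SetLike.mem_coe, hmem, hγA', hγR, map_smul, neg_one_smul, neg_neg, one_smul]
          have h0 := (Submodule.mem_orthogonal _ _).mp hnI (A (R (A (R n)))) ⟨_, hAp, rfl⟩
          -- Self-adjointness of `A R` on `N`, derived from that of `A` and `Q` together with `Q R =
          -- 1` on `N`.
          have h1 : inner ℂ (A (R (A (R n)))) n = inner ℂ (A (R n)) (A (R n)) := by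
            rw [← hQR n hn, ← hQsym, (hQN _).mpr (hAR _ (by rw [hQR n hn]; exact hAN)), hsym,
              hQR n hn]
            nth_rewrite 2 [← (hQN (A (R n))).mpr hAN]
            rw [← hQsym, hQR _ hAN]
          rw [h1] at h0
          exact inner_self_eq_zero.mp h0
        · rw [SetLike.mem_coe, hmem]
          exact hγR
      · rintro x ⟨hx1, hx2⟩
        rw [SetLike.mem_coe, hmem] at hx2
        have hx0 : A x = 0 := hx1
        have hLx' : (L : H →L[ℂ] H) x = Q x := hLQ x (by rw [hx0]; exact zero_mem N)
        have hRQ : R (Q x) = x := by rw [← hLx', hRL]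
        refine ⟨Q x, ⟨?_, N.starProjection_apply_mem x, ?_⟩, hRQ⟩
        · rw [SetLike.mem_coe, Submodule.mem_orthogonal]
          rintro _ ⟨n, ⟨hn, -⟩, rfl⟩
          show inner ℂ (A (R n)) (Q x) = 0
          rw [← hQsym, (hQN _).mpr (hAR n hn), hsym, hx0, inner_zero_right]
        · rw [SetLike.mem_coe, hmem, hγQ', hx2, map_smul]
    rw [← e]
    exact LinearEquiv.finrank_eq (Submodule.equivMapOfInjective (R : H →ₗ[ℂ] H) hRinj _)
  have h1 := finrank_map_add_finrank_inf_ker Np ((A * R : H →L[ℂ] H) : H →ₗ[ℂ] H)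
  have h2 := Submodule.finrank_add_inf_finrank_orthogonal hI_le
  rw [hplus, ← hI] at h1
  rw [hminus] at h2
  omega

theorem starProjection_mul_eq_mul_starProjection (γ : H →L[ℂ] H) (N : Submodule ℂ H)
    [N.HasOrthogonalProjection] (hγ : star γ = γ) (hN : ∀ x ∈ N, γ x ∈ N) :
    γ * N.starProjection = N.starProjection * γ := by
  refine ContinuousLinearMap.ext fun x => ?_
  rw [mul_apply_eq_comp, mul_apply_eq_comp]
  refine Eq.symm <| Submodule.eq_starProjection_of_mem_of_inner_eq_zero
    (hN _ (N.starProjection_apply_mem x)) fun w hw => ?_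
  rw [← map_sub, ← ContinuousLinearMap.adjoint_inner_right,
    ← ContinuousLinearMap.star_eq_adjoint, hγ]
  exact N.starProjection_inner_eq_zero x _ (hN w hw)

/-- Local constancy of the index of the graded kernel. -/
theorem eventually_finrank_gradedKer_eq (A₀ B γ : H →L[ℂ] H) (hA₀ : star A₀ = A₀)
    (hB : IsCompactOperator (B * A₀ - 1 : H →L[ℂ] H)) (hγ : star γ = γ)
    (hγA₀ : γ * A₀ = -(A₀ * γ)) :
    ∀ᶠ A in 𝓝 A₀, star A = A → γ * A = -(A * γ) →
      (Module.finrank ℂ (gradedKer γ A 1) : ℤ) - Module.finrank ℂ (gradedKer γ A (-1)) =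
        Module.finrank ℂ (gradedKer γ A₀ 1) - Module.finrank ℂ (gradedKer γ A₀ (-1)) := by
  have hfin := finiteDimensional_ker_of_leftInverse_mod_compact A₀ B hB
  have hunit := isUnit_starProjection_ker_add A₀ B hA₀ hB
  set N := LinearMap.ker (A₀ : H →ₗ[ℂ] H) with hN
  have hγN : γ * N.starProjection = N.starProjection * γ := by
    refine starProjection_mul_eq_mul_starProjection γ N hγ fun x hx => ?_
    have hx0 : A₀ x = 0 := hx
    have h1 : γ (A₀ x) = -A₀ (γ x) := congrArg (fun T : H →L[ℂ] H => T x) hγA₀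
    rw [hx0, map_zero] at h1
    exact neg_eq_zero.mp h1.symm
  -- At `A₀` the operator `Q + (1 - Q) A` reduces to `Q + A₀`, which is invertible; invertibility is
  -- an open condition.
  have hQA : N.starProjection * A₀ = 0 := by
    have h1 : A₀ * N.starProjection = 0 :=
      ContinuousLinearMap.ext fun x => N.starProjection_apply_mem x
    have h2 := congrArg star h1
    rwa [star_mul, hA₀, isSelfAdjoint_starProjection, star_zero] at h2
  have hcont : Continuous fun A : H →L[ℂ] H =>
      N.starProjection + (1 - N.starProjection) * A := by fun_prop
  have hopen : ∀ᶠ A in 𝓝 A₀, IsUnit (N.starProjection + (1 - N.starProjection) * A) := by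
    refine hcont.continuousAt.eventually (Units.isOpen.mem_nhds ?_)
    show IsUnit (N.starProjection + (1 - N.starProjection) * A₀)
    rw [sub_mul, one_mul, hQA, sub_zero]
    exact hunit
  filter_upwards [hopen] with A hA hsA hγA
  have h := finrank_gradedKer_add_eq A γ N hsA hγA hγN hA
  have e1 : gradedKer γ A₀ 1 = N ⊓ Module.End.eigenspace (γ : H →ₗ[ℂ] H) 1 := rfl
  have e2 : gradedKer γ A₀ (-1) = N ⊓ Module.End.eigenspace (γ : H →ₗ[ℂ] H) (-1) := rfl
  rw [e1, e2]
  omega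

end Fredholm

/-! ### Homotopy invariance of the index of chiral walks -/

section ChiralWalk

variable {H : Type*} [NormedAddCommGroup H] [InnerProductSpace ℂ H] [CompleteSpace H]

/-- Adding the finite-rank spectral projection at `z` to `V - z` makes it invertible; that inverse
serves as `R`. -/
theorem exists_leftInverse_mod_compact_of_gappedAt (V : H →L[ℂ] H) [IsStarNormal V] (z : ℂ)
    (h : IsEssentiallyGappedAt V z) :
    ∃ R : H →L[ℂ] H, IsCompactOperator (R * (V - z • 1) - 1 : H →L[ℂ] H) := by
  obtain ⟨hiso, hfin⟩ := h
  have hc := continuousOn_ite_eq_of_isolated hiso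
  set e := cfc (fun w : ℂ => if w = z then (1 : ℂ) else 0) V with he
  have hz : (V - z • 1) * e = 0 := sub_smul_mul_cfc_ite_eq_zero V hiso
  have hu : IsUnit (V - z • 1 + e) := by
    have h1 : V - z • 1 + e = cfc (fun w : ℂ => w - z + if w = z then (1 : ℂ) else 0) V := by
      rw [cfc_add .., cfc_sub .., cfc_id' ℂ V, cfc_const z V, Algebra.algebraMap_eq_smul_one]
    rw [h1, isUnit_cfc_iff _ V (by fun_prop)]
    intro w _
    by_cases hw : w = z
    · simp [hw]
    · simpa [hw] using sub_ne_zero.mpr hw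
  obtain ⟨u, hu⟩ := hu
  refine ⟨↑u⁻¹, ?_⟩
  have h2 : (↑u⁻¹ : H →L[ℂ] H) * (V - z • 1) - 1 = -(↑u⁻¹ * e) := by
    rw [eq_sub_of_add_eq hu.symm, mul_sub, u.inv_mul]
    abel
  rw [h2]
  have hce : IsCompactOperator e := by
    refine isCompactOperator_of_forall_mem e (Module.End.eigenspace (V : H →ₗ[ℂ] H) z) fun x => ?_
    rw [Module.End.mem_eigenspace_iff]
    have h3 : (V - z • 1) (e x) = 0 := congrArg (fun T : H →L[ℂ] H => T x) hz
    exact sub_eq_zero.mp h3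
  exact (hce.clm_comp (↑u⁻¹ : H →L[ℂ] H)).neg

theorem star_imPart (X : H →L[ℂ] H) : star (imPart X) = imPart X := by
  rw [imPart, star_smul, star_sub, star_star, ← neg_sub, smul_neg, ← neg_smul]
  congr 1
  simp

theorem exists_leftInverse_mod_compact_imPart (V : H →L[ℂ] H) (hV : V ∈ unitary (H →L[ℂ] H))
    (hg : IsEssentiallyGapped V) :
    ∃ G : H →L[ℂ] H, IsCompactOperator (G * imPart V - 1 : H →L[ℂ] H) := by
  obtain ⟨h1, h2⟩ := Unitary.mem_iff.mp hV
  have hn : IsStarNormal V := ⟨by rw [Commute, SemiconjBy, h1, h2]⟩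
  obtain ⟨R, hR⟩ := exists_leftInverse_mod_compact_of_gappedAt V 1 hg.1
  obtain ⟨S, hS⟩ := exists_leftInverse_mod_compact_of_gappedAt V (-1) hg.2
  refine ⟨(2 * Complex.I) • (S * R * V), ?_⟩
  -- For unitary `V` this is `V² - 1 = (V - 1)(V + 1)`, so the gaps at `1` and `-1` together control
  -- the imaginary part.
  have hfac : V * (V - star V) = (V - (1 : ℂ) • 1) * (V - (-1 : ℂ) • 1) := by
    rw [mul_sub, h2, one_smul, neg_one_smul]
    noncomm_ring
  have e : (2 * Complex.I) • (S * R * V) * imPart V - 1 =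
      S * (R * (V - (1 : ℂ) • 1) - 1) * (V - (-1 : ℂ) • 1) + (S * (V - (-1 : ℂ) • 1) - 1) := by
    rw [imPart, smul_mul_smul_comm, mul_inv_cancel₀ (by simp), one_smul, mul_assoc (S * R), hfac]
    generalize V - (1 : ℂ) • 1 = X
    generalize V - (-1 : ℂ) • 1 = Y
    noncomm_ring
  rw [e]
  exact ((hR.clm_comp S).comp_clm _).add hS

/-- The imaginary part of the half-chain operator of `V`, completed by `τ` on the other
half-chain. -/
def chainOp (cells : CellStructure H) (τ : H →L[ℂ] H) (a : ℤ) (V : H →L[ℂ] H) : H →L[ℂ] H :=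
  imPart (cells.halfProj a * V * cells.halfProj a) + (1 - cells.halfProj a) * τ

theorem imPart_compress (cells : CellStructure H) (a : ℤ) (V : H →L[ℂ] H) :
    imPart (cells.halfProj a * V * cells.halfProj a) =
      cells.halfProj a * imPart V * cells.halfProj a := by
  rw [imPart, imPart, star_mul, star_mul, cells.star_halfProj, mul_smul_comm, smul_mul_assoc,
    mul_sub, sub_mul, mul_assoc _ (star V)]

theorem continuous_chainOp (cells : CellStructure H) (τ : H →L[ℂ] H) (a : ℤ) :
    Continuous (chainOp cells τ a) := by
  unfold chainOp imPart
  fun_prop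

section Grading

variable {cells : CellStructure H} {τ γ V : H →L[ℂ] H} {a : ℤ}

theorem star_chainOp (hτ : star τ = τ)
    (hτP : τ * cells.halfProj a = cells.halfProj a * τ) :
    star (chainOp cells τ a V) = chainOp cells τ a V := by
  rw [chainOp, star_add, star_imPart, star_mul, star_sub, star_one, cells.star_halfProj, hτ,
    mul_sub, sub_mul, hτP, one_mul, mul_one]

theorem mul_chainOp (hγ : star γ = γ) (hγγ : γ * γ = 1)
    (hγP : γ * cells.halfProj a = cells.halfProj a * γ) (hγτ : γ * τ = -(τ * γ))
    (hV : γ * V * star γ = star V) :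
    γ * chainOp cells τ a V = -(chainOp cells τ a V * γ) := by
  rw [hγ] at hV
  have h1 : γ * V = star V * γ := by rw [← hV, mul_assoc, hγγ, mul_one]
  have h2 : γ * star V = V * γ := by
    rw [← hV, ← mul_assoc, ← mul_assoc, hγγ, one_mul]
  have h3 : γ * imPart V = -(imPart V * γ) := by
    rw [imPart, mul_smul_comm, mul_sub, h1, h2, smul_mul_assoc, sub_mul, ← smul_neg, neg_sub]
  rw [chainOp, imPart_compress, mul_add, add_mul, neg_add]
  congr 1
  · rw [← mul_assoc, ← mul_assoc, hγP, mul_assoc _ γ, h3, mul_neg, neg_mul, mul_assoc _ _ γ,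
      ← hγP]
    simp only [mul_assoc]
  · rw [← mul_assoc, mul_sub, mul_one, hγP, ← one_sub_mul, mul_assoc, hγτ, mul_neg, mul_assoc]

/-- The two summands live on complementary half-chains and `τ` is invertible on its own, so nothing
is added to the kernel. -/
theorem gradedKer_chainOp (hττ : τ * τ = 1) (hτP : τ * cells.halfProj a = cells.halfProj a * τ)
    (ε : ℂ) : gradedKer γ (chainOp cells τ a V) ε = halfChainKernel cells γ V a ε := by
  have hPP : ∀ x, cells.halfProj a (cells.halfProj a x) = cells.halfProj a x := fun x =>
    congrArg (fun T : H →L[ℂ] H => T x) (cells.halfProj_mul_self a)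
  have hτP' : ∀ x, τ (cells.halfProj a x) = cells.halfProj a (τ x) := fun x =>
    congrArg (fun T : H →L[ℂ] H => T x) hτP
  have hττ' : ∀ x, τ (τ x) = x := fun x => congrArg (fun T : H →L[ℂ] H => T x) hττ
  have hI : ∀ x, cells.halfProj a (imPart (cells.halfProj a * V * cells.halfProj a) x) =
      imPart (cells.halfProj a * V * cells.halfProj a) x := by
    intro x
    rw [imPart_compress]
    exact hPP _
  unfold gradedKer halfChainKernel
  congr 1
  ext x
  rw [LinearMap.mem_ker, Submodule.mem_inf, LinearMap.mem_ker,
    ← cells.halfProj_apply_eq_self_iff]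
  have hx : (chainOp cells τ a V : H →ₗ[ℂ] H) x =
      imPart (cells.halfProj a * V * cells.halfProj a) x + (τ x - cells.halfProj a (τ x)) := rfl
  rw [hx]
  constructor
  · intro h
    have h1 := congrArg (cells.halfProj a) h
    rw [map_add, map_sub, hI, hPP, sub_self, add_zero, map_zero] at h1
    refine ⟨?_, h1⟩
    rw [h1, zero_add, sub_eq_zero] at h
    have h2 := congrArg τ h
    rw [hτP', hττ'] at h2
    exact h2.symm
  · rintro ⟨h1, h2⟩
    have h3 : imPart (cells.halfProj a * V * cells.halfProj a) x = 0 := h2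
    rw [h3, zero_add, ← hτP', h1, sub_self]

/-- The inverse `G` of the imaginary part modulo compacts survives compression to the half-chain
because the commutator with `P` is compact by essential locality. -/
theorem exists_leftInverse_mod_compact_chainOp (hττ : τ * τ = 1)
    (hτP : τ * cells.halfProj a = cells.halfProj a * τ) (hu : V ∈ unitary (H →L[ℂ] H))
    (hloc : IsEssentiallyLocal cells V) (hg : IsEssentiallyGapped V) :
    ∃ B : H →L[ℂ] H, IsCompactOperator (B * chainOp cells τ a V - 1 : H →L[ℂ] H) := by
  obtain ⟨G, hG⟩ := exists_leftInverse_mod_compact_imPart V hu hg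
  have hI : IsEssentiallyLocal cells (imPart V) := by
    rw [imPart, sub_eq_add_neg]
    exact (hloc.add (hloc.star_of_unitary hu).neg).smul _
  have hPP := cells.halfProj_mul_self a
  have hC := hI a
  set P := cells.halfProj a with hP
  refine ⟨P * G * P + (1 - P) * τ, ?_⟩
  have e : (P * G * P + (1 - P) * τ) * chainOp cells τ a V - 1 =
      P * (G * imPart V - 1) * P - P * G * (imPart V * P - P * imPart V) * P := by
    have hPP' : ∀ X, P * (P * X) = P * X := fun X => by rw [← mul_assoc, hPP]
    have hτP' : ∀ X, τ * (P * X) = P * (τ * X) := fun X => by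
      rw [← mul_assoc, hτP, mul_assoc]
    rw [chainOp, imPart_compress]
    simp only [← hP, mul_add, add_mul, mul_sub, sub_mul, one_mul, mul_one, mul_assoc, hPP, hPP',
      hτP', hττ]
    abel
  rw [e]
  exact ((hG.clm_comp P).comp_clm P).sub ((hC.clm_comp (P * G)).comp_clm P)

end Grading

/-- The difference of the dimensions of the `γ = 1` and `γ = -1` parts of the half-chain kernel. -/
def chainIndex (cells : CellStructure H) (γ : H →L[ℂ] H) (a : ℤ) (V : H →L[ℂ] H) : ℤ :=
  (Module.finrank ℂ (halfChainKernel cells γ V a 1) : ℤ) -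
    Module.finrank ℂ (halfChainKernel cells γ V a (-1))

/-- The index is locally constant along the path by `eventually_finrank_gradedKer_eq`, and the unit
interval is connected. The auxiliary `τ` keeps the completed operators self-adjoint and odd on the
whole space. -/
theorem chainIndex_eq_of_joinedIn {cells : CellStructure H} {γ τ : H →L[ℂ] H} {a : ℤ}
    (hγ : star γ = γ) (hγγ : γ * γ = 1) (hγP : γ * cells.halfProj a = cells.halfProj a * γ)
    (hτ : star τ = τ) (hττ : τ * τ = 1) (hτP : τ * cells.halfProj a = cells.halfProj a * τ)
    (hγτ : γ * τ = -(τ * γ)) {V W : H →L[ℂ] H}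
    (h : JoinedIn {U | IsChiralWalk cells γ U} V W) :
    chainIndex cells γ a V = chainIndex cells γ a W := by
  obtain ⟨p, hp⟩ := h
  have hindex : ∀ U : H →L[ℂ] H, chainIndex cells γ a U =
      (Module.finrank ℂ (gradedKer γ (chainOp cells τ a U) 1) : ℤ) -
        Module.finrank ℂ (gradedKer γ (chainOp cells τ a U) (-1)) := fun U => by
    rw [gradedKer_chainOp hττ hτP, gradedKer_chainOp hττ hτP, chainIndex]
  have hlc : IsLocallyConstant fun t : unitInterval => chainIndex cells γ a (p t) := by
    rw [IsLocallyConstant.iff_eventually_eq]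
    intro t
    obtain ⟨B, hB⟩ := exists_leftInverse_mod_compact_chainOp (a := a) hττ hτP (hp t).unitary
      (hp t).essLocal (hp t).gapped
    have hev := eventually_finrank_gradedKer_eq (chainOp cells τ a (p t)) B γ
      (star_chainOp hτ hτP) hB hγ (mul_chainOp hγ hγγ hγP hγτ (hp t).chiral)
    have hcont : Continuous fun s : unitInterval => chainOp cells τ a (p s) :=
      (continuous_chainOp cells τ a).comp p.continuous
    filter_upwards [hcont.continuousAt.eventually hev] with s hs
    rw [hindex, hindex]
    exact hs (star_chainOp hτ hτP) (mul_chainOp hγ hγγ hγP hγτ (hp s).chiral)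
  have h1 := hlc.apply_eq_of_preconnectedSpace 0 1
  simpa using h1

theorem isChiralWalk_timeframeW' {cells : CellStructure H} {γ F : H →L[ℂ] H}
    (hγ : star γ = γ) (hγγ : γ * γ = 1) (hγloc : IsEssentiallyLocal cells γ)
    (hF : IsHalfStepWalk cells γ F) : IsChiralWalk cells γ (timeframeW' γ F) := by
  have hγu : γ ∈ unitary (H →L[ℂ] H) := by
    rw [Unitary.mem_iff, hγ]
    exact ⟨hγγ, hγγ⟩
  refine ⟨?_, ?_, ?_, hF.gappedW'⟩
  · exact mul_mem (mul_mem (mul_mem hF.unitary hγu) (Unitary.star_mem hF.unitary)) hγu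
  · exact ((hF.essLocal.mul hγloc).mul (hF.essLocal.star_of_unitary hF.unitary)).mul hγloc
  · simp only [timeframeW', star_mul, star_star, hγ, mul_assoc, hγγ, mul_one]

theorem joinedIn_timeframeW' {cells : CellStructure H} {γ F F' : H →L[ℂ] H}
    (hγ : star γ = γ) (hγγ : γ * γ = 1) (hγloc : IsEssentiallyLocal cells γ)
    (h : JoinedIn {F | IsHalfStepWalk cells γ F} F F') :
    JoinedIn {V | IsChiralWalk cells γ V} (timeframeW' γ F) (timeframeW' γ F') := by
  have hc : Continuous (timeframeW' γ : (H →L[ℂ] H) → (H →L[ℂ] H)) := by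
    unfold timeframeW'
    fun_prop
  obtain ⟨p, hp⟩ := h
  exact ⟨p.map hc, fun t => isChiralWalk_timeframeW' hγ hγγ hγloc (hp t)⟩

end ChiralWalk

/-! ### Indices of the two timeframes over the phase diagram -/

namespace SplitStep

theorem norm_ofReal_lt_of_sq_lt {x y : ℝ} (h : x ^ 2 < y ^ 2) : ‖(x : ℂ)‖ < ‖(y : ℂ)‖ := by
  rw [Complex.norm_real, Complex.norm_real]
  exact sq_lt_sq.mp h

section Norms

variable {θ : ℝ × ℝ}

theorem norm_cp_cm_lt (h : Real.sin θ.2 < Real.sin θ.1) :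
    ‖((cp θ.2 * cm θ.1 : ℝ) : ℂ)‖ < ‖((cm θ.2 * cp θ.1 : ℝ) : ℂ)‖ := by
  refine norm_ofReal_lt_of_sq_lt ?_
  rw [mul_pow, mul_pow, cp_sq, cp_sq, cm_sq, cm_sq]
  linarith

theorem norm_cm_cp_lt (h : Real.sin θ.1 < Real.sin θ.2) :
    ‖((cm θ.2 * cp θ.1 : ℝ) : ℂ)‖ < ‖((cp θ.2 * cm θ.1 : ℝ) : ℂ)‖ := by
  refine norm_ofReal_lt_of_sq_lt ?_
  rw [mul_pow, mul_pow, cp_sq, cp_sq, cm_sq, cm_sq]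
  linarith

theorem norm_cp_cp_lt (h : Real.sin θ.1 + Real.sin θ.2 < 0) :
    ‖((cp θ.2 * cp θ.1 : ℝ) : ℂ)‖ < ‖((cm θ.2 * cm θ.1 : ℝ) : ℂ)‖ := by
  refine norm_ofReal_lt_of_sq_lt ?_
  rw [mul_pow, mul_pow, cp_sq, cp_sq, cm_sq, cm_sq]
  linarith

theorem norm_cm_cm_lt (h : 0 < Real.sin θ.1 + Real.sin θ.2) :
    ‖((cm θ.2 * cm θ.1 : ℝ) : ℂ)‖ < ‖((cp θ.2 * cp θ.1 : ℝ) : ℂ)‖ := by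
  refine norm_ofReal_lt_of_sq_lt ?_
  rw [mul_pow, mul_pow, cp_sq, cp_sq, cm_sq, cm_sq]
  linarith

theorem norm_ofReal_neg (x : ℝ) : ‖((-x : ℝ) : ℂ)‖ = ‖(x : ℂ)‖ := by
  rw [Complex.ofReal_neg, norm_neg]

end Norms

theorem ne_zero_of_norm_lt {u v : ℂ} (h : ‖v‖ < ‖u‖) : u ≠ 0 :=
  norm_pos_iff.mp ((norm_nonneg v).trans_lt h)

/-- By translation invariance the dimensions do not depend on the cut, so one computation serves
every regrouping. -/
theorem hasRightSymmetryIndex_of_finrank {c : ℤ → ℤ} {hc : StrictMono c} {V : Hilb →L[ℂ] Hilb}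
    {m n : ℕ}
    (hm : ∀ b, FiniteDimensional ℂ (halfChainKernel stdCells chi V b 1) ∧
      Module.finrank ℂ (halfChainKernel stdCells chi V b 1) = m)
    (hn : ∀ b, FiniteDimensional ℂ (halfChainKernel stdCells chi V b (-1)) ∧
      Module.finrank ℂ (halfChainKernel stdCells chi V b (-1)) = n) :
    HasRightSymmetryIndex (stdCells.regroup c hc) chi V ((m : ℤ) - n) := by
  intro a
  rw [halfChainKernel_regroup, halfChainKernel_regroup, (hm (c a)).2, (hn (c a)).2]
  exact ⟨(hm (c a)).1, (hn (c a)).1, rfl⟩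

theorem finrank_of_eq_bot {S : Submodule ℂ Hilb} (h : S = ⊥) :
    FiniteDimensional ℂ S ∧ Module.finrank ℂ S = 0 := by
  subst h
  exact ⟨inferInstance, finrank_bot ℂ Hilb⟩

section Indices

variable {c : ℤ → ℤ} {hc : StrictMono c} {θ : ℝ × ℝ}

theorem one_mul_self : (1 : ℂ) * 1 = 1 := one_mul 1

theorem neg_one_mul_self : (-1 : ℂ) * -1 = 1 := by norm_num

theorem hasRightSymmetryIndex_timeframeW_patchPlus (h : θ ∈ patchPlus) :
    HasRightSymmetryIndex (stdCells.regroup c hc) chi (timeframeW chi (halfStep θ)) 0 := by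
  have h0 : |Real.sin θ.1| < Real.sin θ.2 := h
  obtain ⟨h1, h2⟩ := abs_lt.mp h0
  have hA := norm_cm_cp_lt (θ := θ) h2
  have hB := norm_cm_cm_lt (θ := θ) (by linarith)
  rw [← norm_ofReal_neg (cm _ * cm _)] at hB
  exact hasRightSymmetryIndex_of_finrank (m := 0) (n := 0)
    (fun b => finrank_of_eq_bot
      ((imFactors_timeframeW_one θ).halfChainKernel_eq_bot_of_gt one_mul_self hB hA b))
    (fun b => finrank_of_eq_bot
      ((imFactors_timeframeW_neg_one θ).halfChainKernel_eq_bot_of_gt neg_one_mul_self hA hB b))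

theorem hasRightSymmetryIndex_timeframeW_patchMinus (h : θ ∈ patchMinus) :
    HasRightSymmetryIndex (stdCells.regroup c hc) chi (timeframeW chi (halfStep θ)) 0 := by
  have h0 : |Real.sin θ.1| < -Real.sin θ.2 := lt_neg.mp h
  obtain ⟨h1, h2⟩ := abs_lt.mp h0
  have hA := norm_cp_cm_lt (θ := θ) (by linarith)
  have hB := norm_cp_cp_lt (θ := θ) (by linarith)
  rw [← norm_ofReal_neg (cm _ * cm _)] at hB
  exact hasRightSymmetryIndex_of_finrank (m := 0) (n := 0)
    (fun b => finrank_of_eq_bot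
      ((imFactors_timeframeW_one θ).halfChainKernel_eq_bot_of_lt one_mul_self hB
        (Or.inr (ne_zero_of_norm_lt hA)) b))
    (fun b => finrank_of_eq_bot
      ((imFactors_timeframeW_neg_one θ).halfChainKernel_eq_bot_of_lt neg_one_mul_self hA
        (Or.inr (ne_zero_of_norm_lt hB)) b))

/-- The remaining gapped regions are needed only to show that the index of `W` vanishes nowhere
outside the two patches. -/
theorem hasRightSymmetryIndex_timeframeW_of_abs_lt_sin (h : |Real.sin θ.2| < Real.sin θ.1) :
    HasRightSymmetryIndex (stdCells.regroup c hc) chi (timeframeW chi (halfStep θ)) 1 := by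
  obtain ⟨h1, h2⟩ := abs_lt.mp h
  have hA := norm_cp_cm_lt (θ := θ) h2
  have hB := norm_cm_cm_lt (θ := θ) (by linarith)
  rw [← norm_ofReal_neg (cm _ * cm _)] at hB
  exact hasRightSymmetryIndex_of_finrank (m := 1) (n := 0)
    (fun b =>
      (imFactors_timeframeW_one θ).finrank_halfChainKernel_eq_one one_mul_self hB hA b)
    (fun b => finrank_of_eq_bot
      ((imFactors_timeframeW_neg_one θ).halfChainKernel_eq_bot_of_lt neg_one_mul_self hA
        (Or.inl (ne_zero_of_norm_lt hB)) b))

theorem hasRightSymmetryIndex_timeframeW_of_sin_lt_neg_abs (h : Real.sin θ.1 < -|Real.sin θ.2|) :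
    HasRightSymmetryIndex (stdCells.regroup c hc) chi (timeframeW chi (halfStep θ)) (-1) := by
  have h0 : |Real.sin θ.2| < -Real.sin θ.1 := lt_neg.mp h
  obtain ⟨h1, h2⟩ := abs_lt.mp h0
  have hA := norm_cm_cp_lt (θ := θ) (by linarith)
  have hB := norm_cp_cp_lt (θ := θ) (by linarith)
  rw [← norm_ofReal_neg (cm _ * cm _)] at hB
  exact hasRightSymmetryIndex_of_finrank (m := 0) (n := 1)
    (fun b => finrank_of_eq_bot
      ((imFactors_timeframeW_one θ).halfChainKernel_eq_bot_of_lt one_mul_self hB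
        (Or.inl (ne_zero_of_norm_lt hA)) b))
    (fun b =>
      (imFactors_timeframeW_neg_one θ).finrank_halfChainKernel_eq_one neg_one_mul_self hA hB b)

theorem hasRightSymmetryIndex_timeframeW'_patchPlus (h : θ ∈ patchPlus) :
    HasRightSymmetryIndex (stdCells.regroup c hc) chi (timeframeW' chi (halfStep θ)) 1 := by
  have h0 : |Real.sin θ.1| < Real.sin θ.2 := h
  obtain ⟨h1, h2⟩ := abs_lt.mp h0
  have hA := norm_cm_cp_lt (θ := θ) h2
  have hB := norm_cm_cm_lt (θ := θ) (by linarith)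
  rw [← norm_ofReal_neg (cp _ * cp _)] at hB
  exact hasRightSymmetryIndex_of_finrank (m := 1) (n := 0)
    (fun b =>
      (imFactors_timeframeW'_one θ).finrank_halfChainKernel_eq_one one_mul_self hA hB b)
    (fun b => finrank_of_eq_bot
      ((imFactors_timeframeW'_neg_one θ).halfChainKernel_eq_bot_of_lt neg_one_mul_self hB
        (Or.inl (ne_zero_of_norm_lt hA)) b))

theorem hasRightSymmetryIndex_timeframeW'_patchMinus (h : θ ∈ patchMinus) :
    HasRightSymmetryIndex (stdCells.regroup c hc) chi (timeframeW' chi (halfStep θ)) (-1) := by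
  have h0 : |Real.sin θ.1| < -Real.sin θ.2 := lt_neg.mp h
  obtain ⟨h1, h2⟩ := abs_lt.mp h0
  have hA := norm_cp_cm_lt (θ := θ) (by linarith)
  have hB := norm_cp_cp_lt (θ := θ) (by linarith)
  rw [← norm_ofReal_neg (cp _ * cp _)] at hB
  exact hasRightSymmetryIndex_of_finrank (m := 0) (n := 1)
    (fun b => finrank_of_eq_bot
      ((imFactors_timeframeW'_one θ).halfChainKernel_eq_bot_of_lt one_mul_self hA
        (Or.inl (ne_zero_of_norm_lt hB)) b))
    (fun b =>
      (imFactors_timeframeW'_neg_one θ).finrank_halfChainKernel_eq_one neg_one_mul_self hB hA b)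

end Indices

/-- The operator `1 ⊗ σ₃`, which anticommutes with the chiral symmetry. -/
def sigmaThree : Hilb →L[ℂ] Hilb := cellwise !![1, 0; 0, -1]

theorem star_sigmaThree : star sigmaThree = sigmaThree := by
  rw [sigmaThree, star_cellwise]
  congr 1
  ext i j
  fin_cases i <;> fin_cases j <;> simp

theorem sigmaThree_mul_self : sigmaThree * sigmaThree = 1 := by
  refine ContinuousLinearMap.ext fun φ => Hilb.ext fun x i => ?_
  fin_cases i <;> simp [sigmaThree]

theorem chi_mul_sigmaThree : chi * sigmaThree = -(sigmaThree * chi) := by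
  rw [← add_eq_zero_iff_eq_neg]
  refine ContinuousLinearMap.ext fun φ => Hilb.ext fun x i => ?_
  rw [add_apply, Hilb.add_apply]
  fin_cases i <;> simp [sigmaThree]

theorem not_joinedIn_timeframeW' {c : ℤ → ℤ} (hc : StrictMono c) {θ η : ℝ × ℝ}
    (hθ : θ ∈ patchPlus) (hη : η ∈ patchMinus) :
    ¬ JoinedIn {V | IsChiralWalk (stdCells.regroup c hc) chi V}
      (timeframeW' chi (halfStep θ)) (timeframeW' chi (halfStep η)) := by
  intro h
  have hP := stdCells.halfProj_regroup c hc 0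
  have h1 := chainIndex_eq_of_joinedIn (a := 0) star_chi chi_mul_chi
    (by rw [hP]; exact cellwise_mul_halfProj _ _) star_sigmaThree sigmaThree_mul_self
    (by rw [hP]; exact cellwise_mul_halfProj _ _) chi_mul_sigmaThree h
  have h2 := (hasRightSymmetryIndex_timeframeW'_patchPlus (hc := hc) hθ 0).2.2
  have h3 := (hasRightSymmetryIndex_timeframeW'_patchMinus (hc := hc) hη 0).2.2
  unfold chainIndex at h1
  omega

end SplitStep

end

theorem mainTheorem11 (cells : CellStructure SplitStep.Hilb)
    (hcells : cells.IsRegroupingOf SplitStep.stdCells) :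
    -- the split-step walk is the first timeframe of the half-step operator
    (∀ θ : ℝ × ℝ, timeframeW SplitStep.chi (SplitStep.halfStep θ) = SplitStep.walk θ) ∧
    -- the phase diagram: where the gaps are open
    (∀ θ : ℝ × ℝ,
      SplitStep.halfStep θ ∈ unitary (SplitStep.Hilb →L[ℂ] SplitStep.Hilb) ∧
      IsEssentiallyLocal cells (SplitStep.halfStep θ) ∧
      (IsEssentiallyGapped (timeframeW SplitStep.chi (SplitStep.halfStep θ)) ↔
        |Real.sin θ.1| ≠ |Real.sin θ.2|) ∧
      (IsEssentiallyGapped (timeframeW' SplitStep.chi (SplitStep.halfStep θ)) ↔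
        |Real.sin θ.1| ≠ |Real.sin θ.2|)) ∧
    -- the patches with vanishing right symmetry index of the first timeframe
    (∀ θ : ℝ × ℝ, IsHalfStepWalk cells SplitStep.chi (SplitStep.halfStep θ) →
      (HasRightSymmetryIndex cells SplitStep.chi
          (timeframeW SplitStep.chi (SplitStep.halfStep θ)) 0 ↔
        θ ∈ SplitStep.patchPlus ∪ SplitStep.patchMinus)) ∧
    (0, Real.pi / 2) ∈ SplitStep.patchPlus ∧ (0, -(Real.pi / 2)) ∈ SplitStep.patchMinus ∧
    -- the right symmetry index of the second timeframe in the two patches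
    (∀ θ ∈ SplitStep.patchPlus, HasRightSymmetryIndex cells SplitStep.chi
      (timeframeW' SplitStep.chi (SplitStep.halfStep θ)) 1) ∧
    (∀ θ ∈ SplitStep.patchMinus, HasRightSymmetryIndex cells SplitStep.chi
      (timeframeW' SplitStep.chi (SplitStep.halfStep θ)) (-1)) ∧
    -- no bridge between the two patches
    (∀ θ ∈ SplitStep.patchPlus, ∀ η ∈ SplitStep.patchMinus,
      ¬ JoinedIn {F | IsHalfStepWalk cells SplitStep.chi F}
        (SplitStep.halfStep θ) (SplitStep.halfStep η)) ∧
    -- not even for the second timeframe alone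
    (∀ θ ∈ SplitStep.patchPlus, ∀ η ∈ SplitStep.patchMinus,
      ¬ JoinedIn {V | IsChiralWalk cells SplitStep.chi V}
        (timeframeW' SplitStep.chi (SplitStep.halfStep θ))
        (timeframeW' SplitStep.chi (SplitStep.halfStep η))) := by
  obtain ⟨c, hc, rfl⟩ := hcells
  have hgapW : ∀ θ : ℝ × ℝ,
      IsEssentiallyGapped (timeframeW SplitStep.chi (SplitStep.halfStep θ)) ↔
        |Real.sin θ.1| ≠ |Real.sin θ.2| := fun θ => by
    rw [SplitStep.timeframeW_halfStep]
    exact SplitStep.isEssentiallyGapped_iff _ (SplitStep.walk_mem_unitary θ) _ _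
      (SplitStep.walk_add_star_walk θ)
  refine ⟨SplitStep.timeframeW_halfStep, fun θ => ⟨SplitStep.halfStep_mem_unitary θ,
    (SplitStep.isEssentiallyLocal_halfStep θ).regroup c hc, hgapW θ,
    SplitStep.isEssentiallyGapped_iff _ (SplitStep.timeframeW'_mem_unitary θ) _ _
      (SplitStep.timeframeW'_add_star θ)⟩, fun θ hθ => ?_, ?_, ?_,
    fun θ hθ => SplitStep.hasRightSymmetryIndex_timeframeW'_patchPlus hθ,
    fun θ hθ => SplitStep.hasRightSymmetryIndex_timeframeW'_patchMinus hθ,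
    fun θ hθ η hη h => SplitStep.not_joinedIn_timeframeW' hc hθ hη
      (joinedIn_timeframeW' SplitStep.star_chi SplitStep.chi_mul_chi
        ((SplitStep.isEssentiallyLocal_cellwise _).regroup c hc) h),
    fun θ hθ η hη => SplitStep.not_joinedIn_timeframeW' hc hθ hη⟩
  · constructor
    · intro h
      by_contra hnot
      have hne := (hgapW θ).mp hθ.gappedW
      have h0 := (h 0).2.2
      have hnp : ¬ |Real.sin θ.1| < Real.sin θ.2 := fun hp => hnot (Or.inl hp)
      have hnm : ¬ Real.sin θ.2 < -|Real.sin θ.1| := fun hm => hnot (Or.inr hm)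
      -- Outside both patches `|sin θ₂| ≤ |sin θ₁|`, and the open gap excludes equality; the sign of
      -- `sin θ₁` then selects index `1` or `-1`.
      have hlt : |Real.sin θ.2| < |Real.sin θ.1| :=
        lt_of_le_of_ne (abs_le.mpr ⟨not_lt.mp hnm, not_lt.mp hnp⟩) hne.symm
      rcases lt_abs.mp hlt with hs | hs
      · have := (SplitStep.hasRightSymmetryIndex_timeframeW_of_abs_lt_sin (hc := hc) hs 0).2.2
        omega
      · have := (SplitStep.hasRightSymmetryIndex_timeframeW_of_sin_lt_neg_abs (hc := hc)
          (lt_neg.mp hs) 0).2.2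
        omega
    · rintro (h | h)
      · exact SplitStep.hasRightSymmetryIndex_timeframeW_patchPlus h
      · exact SplitStep.hasRightSymmetryIndex_timeframeW_patchMinus h
  · simp [SplitStep.patchPlus]
  · simp [SplitStep.patchMinus]
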